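/- Let $1\le p<2$. There is a constant $\kappa_p>1$ depending only on $p$ such that the following holds. Let $(\varepsilon_i)_{i\in\mathbb Z}$ be an i.i.d. sequence of random vectors with values in $\mathbb R^d$, and let $h\colon\mathbb R^d\times\mathbb R^d\to\mathbb R$ be a measurable function which is symmetric, i.e. $h(x,y)=h(y,x)$ for all $x,y$. For $n\ge 1$ put $$U_n^{\mathrm{ind}}=\sum_{1\le i<j\le n}h(\varepsilon_i,\varepsilon_j),\qquad M_p=\sup_{n\ge 1}\frac{1}{n^{2/p}}\left|U_n^{\mathrm{ind}}\right|\in[0,+\infty].$$ Assume that $\mathbb E|h(\varepsilon_0,\varepsilon_1)|^p<\infty$ and that, for every $x\in\mathbb R^d$, the random variable $h(\varepsilon_0,x)$ is integrable with $\mathbb E\,h(\varepsilon_0,x)=0$. Then: 1. the sequence $\left(n^{-2/p}\left|U_n^{\mathrm{ind}}\right|\right)_{n\ge1}$ converges to $0$ almost surely; 2. for every $x>0$, $$x^p\,\mathbb P\{M_p>x\}\le \kappa_p\,\mathbb E|h(\varepsilon_0,\varepsilon_1)|^p .$$ -/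

import Mathlib

open MeasureTheory ProbabilityTheory Filter Topology
open scoped ENNReal

/-- The U-statistic of order two with kernel `h` evaluated at the data `e`:
the sum of `h (e i) (e j)` over all integers `1 ≤ i < j ≤ n`. -/
def UInd {E : Type*} (h : E → E → ℝ) (e : ℤ → E) (n : ℕ) : ℝ :=
  ∑ j ∈ Finset.Icc 1 n, ∑ i ∈ Finset.Ico 1 j, h (e (i : ℤ)) (e (j : ℤ))

/-- The maximal function: the supremum over `n ≥ 1` of `n ^ (-2/p) * |U_n|`,
as an extended non-negative number. -/
noncomputable def maximalFun {E : Type*} (p : ℝ) (h : E → E → ℝ) (e : ℤ → E) : ℝ≥0∞ :=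
  ⨆ (n : ℕ) (_ : 1 ≤ n), ENNReal.ofReal ((n : ℝ) ^ (-(2 / p)) * |UInd h e n|)

/-- `ε` is a sequence of independent, identically distributed random variables. -/
structure IsIIDSeq {Ω E : Type*} [MeasurableSpace Ω] [MeasurableSpace E]
    (ε : ℤ → Ω → E) (μ : Measure Ω) : Prop where
  measurable : ∀ i, Measurable (ε i)
  indep : iIndepFun ε μ
  identDistrib : ∀ i, IdentDistrib (ε i) (ε 0) μ μ

/-! Indices start at 0, and the pair `i < j` is truncated at `level p j` = (j+1)^(2/p), which is
also the normalisation. By homogeneity it suffices to bound the probability that |U| exceeds the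
level for some n. Three exceptional events are bounded by a multiple of E|h|^p.

(a) Some |h(X_i, X_j)| exceeds its level. There are j pairs with larger index j, so the union bound
gives Σ_j j P(|h| > level j) ≤ E|h|^p. Off this event truncation changes nothing, and the truncated
kernel splits by Hoeffding into `degPart` + `linPart`.

(b) The degenerate part is large. The sums over `i < j` are martingale differences in j with
orthogonal summands, so a Hájek–Rényi inequality reduces the bound to Σ_j j E[h²; |h| ≤ level j] /
(level j)², which is controlled because p < 2.

(c) The linear part is large. Since h is degenerate, the projection of its truncation is minus the
projection of its tail. For p > 1, Markov's inequality leads to Σ_j (j / level j) E[|h|; |h| > level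
j], again at most a multiple of E|h|^p. For p = 1 this sum loses a logarithm; instead the linear
part is dominated through g(x) = E|h(x, ·)|, and the weak (1,1) maximal inequality for averages of
g(X_i) applies.

Almost sure convergence follows by density. For a bounded kernel, the weak type inequality at an
exponent q in (p, 2) gives a faster rate than needed. A general kernel is an L^p limit of bounded
degenerate ones, and the weak type inequality controls the remainder uniformly in n. -/

/-! ### Elementary bounds for power sums. -/

/-- A discrete substitute for integrating x^(-1-q), used for telescoping. The power sits at the left
endpoint, so 1/q is too small a constant; 2 + q comes from x + 1 + q ≤ (2 + q) x for x ≥ 1. -/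
lemma rpow_neg_one_add_le_sub {q x : ℝ} (hq : 0 < q) (hx : 1 ≤ x) :
    x ^ (-(1 + q)) ≤ (2 + q) / q * (x ^ (-q) - (x + 1) ^ (-q)) := by
  have hx0 : 0 < x := by linarith
  have h1 : (x / (x + 1)) ^ q ≤ (x + 1) / (x + 1 + q) := by
    have hlog : Real.log (x / (x + 1)) ≤ -1 / (x + 1) := by
      have := Real.log_le_sub_one_of_pos (show 0 < x / (x + 1) by positivity)
      have h2 : x / (x + 1) - 1 = -1 / (x + 1) := by field_simp; ring
      linarith
    have h3 : (x / (x + 1)) ^ q ≤ Real.exp (-(q / (x + 1))) := by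
      rw [Real.rpow_def_of_pos (by positivity)]
      apply Real.exp_le_exp.2
      calc Real.log (x / (x + 1)) * q ≤ -1 / (x + 1) * q := by gcongr
        _ = -(q / (x + 1)) := by ring
    refine h3.trans ?_
    rw [Real.exp_neg]
    have h4 : (x + 1) / (x + 1 + q) = (1 + q / (x + 1))⁻¹ := by field_simp
    rw [h4]
    apply inv_anti₀ (by positivity)
    linarith [Real.add_one_le_exp (q / (x + 1))]
  have h5 : (x + 1) ^ (-q) = x ^ (-q) * (x / (x + 1)) ^ q := by
    rw [Real.div_rpow hx0.le (by linarith), Real.rpow_neg hx0.le, Real.rpow_neg (by linarith)]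
    have : x ^ q ≠ 0 := (Real.rpow_pos_of_pos hx0 q).ne'
    field_simp
  have h6 : x ^ (-(1 + q)) = x ^ (-q) * x⁻¹ := by
    rw [show -(1 + q) = -q + -1 by ring, Real.rpow_add hx0, Real.rpow_neg_one]
  have h7 : x⁻¹ ≤ (2 + q) / q * (1 - (x / (x + 1)) ^ q) := by
    have h8 : q / (x + 1 + q) ≤ 1 - (x / (x + 1)) ^ q := by
      have : q / (x + 1 + q) = 1 - (x + 1) / (x + 1 + q) := by field_simp; ring
      linarith
    calc x⁻¹ ≤ (2 + q) / q * (q / (x + 1 + q)) := by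
          rw [inv_eq_one_div, div_mul_div_comm, div_le_div_iff₀ hx0 (by positivity)]
          nlinarith [mul_nonneg hq.le (sub_nonneg.2 hx), mul_nonneg (mul_nonneg hq.le hq.le) (sub_nonneg.2 hx)]
      _ ≤ _ := by gcongr
  rw [h5, h6]
  calc x ^ (-q) * x⁻¹ ≤ x ^ (-q) * ((2 + q) / q * (1 - (x / (x + 1)) ^ q)) := by gcongr
    _ = _ := by ring

/-- Bernoulli's inequality for a concave power, at 1 - 1/(x+1). -/
lemma rpow_sub_one_le_sub {r x : ℝ} (hr : 0 < r) (hr1 : r ≤ 1) (hx : 0 ≤ x) :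
    (x + 1) ^ (r - 1) ≤ r⁻¹ * ((x + 1) ^ r - x ^ r) := by
  have hx1 : 0 < x + 1 := by linarith
  have h1 : (1 + -(x + 1)⁻¹) ^ r ≤ 1 + r * -(x + 1)⁻¹ := by
    refine rpow_one_add_le_one_add_mul_self ?_ hr.le hr1
    have : (x + 1)⁻¹ ≤ 1 := inv_le_one_of_one_le₀ (by linarith)
    linarith
  have h2 : 1 + -(x + 1)⁻¹ = x / (x + 1) := by field_simp; ring
  rw [h2, Real.div_rpow hx hx1.le, div_le_iff₀ (by positivity)] at h1
  rw [Real.rpow_sub_one hx1.ne', inv_mul_eq_div, le_div_iff₀ hr]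
  have h3 : (1 + r * -(x + 1)⁻¹) * (x + 1) ^ r = (x + 1) ^ r - (x + 1) ^ r / (x + 1) * r := by
    field_simp; ring
  linarith

lemma sum_le_of_le_mul_sub {f a : ℕ → ℝ} {C : ℝ} (h : ∀ j, f j ≤ C * (a (j + 1) - a j)) (N : ℕ) :
    ∑ j ∈ Finset.range N, f j ≤ C * (a N - a 0) := by
  calc _ ≤ ∑ j ∈ Finset.range N, C * (a (j + 1) - a j) := Finset.sum_le_sum fun j _ => h j
    _ = _ := by rw [← Finset.mul_sum, Finset.sum_range_sub]

lemma sum_rpow_tail_le {q : ℝ} (hq : 0 < q) (t : ℝ) (N : ℕ) :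
    ∑ j ∈ Finset.range N, (if t ≤ (j : ℝ) + 1 then ((j : ℝ) + 1) ^ (-(1 + q)) else 0) ≤
      (2 + q) / q * (max 1 t) ^ (-q) := by
  have key := sum_le_of_le_mul_sub (C := (2 + q) / q)
    (f := fun j : ℕ => if t ≤ (j : ℝ) + 1 then ((j : ℝ) + 1) ^ (-(1 + q)) else 0)
    -- The telescoping potential stays constant until j + 1 passes t, so the vanishing terms cost
    -- nothing.
    (a := fun j : ℕ => -(max (max 1 t) ((j : ℝ) + 1)) ^ (-q)) ?_ N
  · refine key.trans ?_
    gcongr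
    have h1 : 0 ≤ (max (max 1 t) ((N : ℝ) + 1)) ^ (-q) := by positivity
    simp only [Nat.cast_zero, zero_add]
    rw [max_eq_left (le_max_left 1 t)]
    linarith
  · intro j
    have hj : (0 : ℝ) ≤ j := j.cast_nonneg
    split_ifs with h
    · have h1 : max 1 t ≤ (j : ℝ) + 1 := max_le (by linarith) h
      rw [max_eq_right h1, max_eq_right (by push_cast; linarith)]
      have := rpow_neg_one_add_le_sub hq (show 1 ≤ (j : ℝ) + 1 by linarith)
      push_cast
      linarith
    · have : (max (max 1 t) (((j + 1 : ℕ) : ℝ) + 1)) ^ (-q) ≤ (max (max 1 t) ((j : ℝ) + 1)) ^ (-q) := by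
        apply Real.rpow_le_rpow_of_nonpos
        · positivity
        · gcongr; linarith
        · linarith
      have h2 : 0 ≤ (2 + q) / q := by positivity
      apply mul_nonneg h2
      linarith

lemma sum_rpow_head_le {r : ℝ} (hr : 0 < r) (hr1 : r ≤ 1) {t : ℝ} (ht : 0 ≤ t) (N : ℕ) :
    ∑ j ∈ Finset.range N, (if (j : ℝ) + 1 < t then ((j : ℝ) + 1) ^ (r - 1) else 0) ≤
      r⁻¹ * t ^ r := by
  have key := sum_le_of_le_mul_sub (C := r⁻¹)
    (f := fun j : ℕ => if (j : ℝ) + 1 < t then ((j : ℝ) + 1) ^ (r - 1) else 0)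
    (a := fun j : ℕ => (min t (j : ℝ)) ^ r) ?_ N
  · refine key.trans ?_
    gcongr
    simp only [Nat.cast_zero, min_eq_right ht, Real.zero_rpow hr.ne', sub_zero]
    exact Real.rpow_le_rpow (by positivity) (min_le_left _ _) hr.le
  · intro j
    have hj : (0 : ℝ) ≤ j := j.cast_nonneg
    split_ifs with h
    · push_cast
      rw [min_eq_right h.le, min_eq_right (by linarith)]
      exact rpow_sub_one_le_sub hr hr1 hj
    · have : (min t (j : ℝ)) ^ r ≤ (min t ((j + 1 : ℕ) : ℝ)) ^ r := by
        apply Real.rpow_le_rpow (by positivity) _ hr.le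
        gcongr; linarith
      have h2 : 0 ≤ r⁻¹ := by positivity
      apply mul_nonneg h2
      linarith

lemma sum_nat_head_le {t : ℝ} (ht : 0 ≤ t) (N : ℕ) :
    ∑ j ∈ Finset.range N, (if (j : ℝ) + 1 < t then (j : ℝ) else 0) ≤ t ^ 2 := by
  have key := sum_le_of_le_mul_sub (C := 1)
    (f := fun j : ℕ => if (j : ℝ) + 1 < t then (j : ℝ) else 0)
    (a := fun j : ℕ => (min t (j : ℝ)) ^ 2) ?_ N
  · refine key.trans ?_
    simp only [Nat.cast_zero, min_eq_right ht, one_mul]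
    have : min t (N : ℝ) ≤ t := min_le_left _ _
    have h0 : 0 ≤ min t (N : ℝ) := by positivity
    nlinarith
  · intro j
    have hj : (0 : ℝ) ≤ j := j.cast_nonneg
    split_ifs with h
    · push_cast
      rw [min_eq_right h.le, min_eq_right (by linarith)]
      nlinarith
    · have h1 : min t (j : ℝ) ≤ min t ((j + 1 : ℕ) : ℝ) := by gcongr; linarith
      have h0 : 0 ≤ min t (j : ℝ) := by positivity
      nlinarith

/-! ### Sums over truncation levels. -/

/-- The truncation level and normalisation `(j + 1) ^ (2 / p)`. -/
noncomputable def level (p : ℝ) (j : ℕ) : ℝ := ((j : ℝ) + 1) ^ (2 / p)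

lemma level_pos (p : ℝ) (j : ℕ) : 0 < level p j := by unfold level; positivity

lemma level_mono {p : ℝ} (hp : 0 < p) : Monotone (level p) := by
  intro i j hij
  unfold level
  gcongr

lemma level_one (j : ℕ) : level 1 j = ((j : ℝ) + 1) ^ 2 := by
  unfold level; norm_num

lemma level_lt_iff {p : ℝ} (hp : 0 < p) (a : ℝ) (j : ℕ) :
    level p j < |a| ↔ (j : ℝ) + 1 < |a| ^ (p / 2) := by
  unfold level
  rw [← Real.rpow_lt_rpow_iff (z := p / 2) (by positivity) (by positivity) (by positivity),
    ← Real.rpow_mul (by positivity), show 2 / p * (p / 2) = 1 by field_simp, Real.rpow_one]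

lemma rpow_half_sq (p a : ℝ) : (|a| ^ (p / 2)) ^ (2 : ℕ) = |a| ^ p := by
  rw [← Real.rpow_natCast, ← Real.rpow_mul (abs_nonneg a)]
  norm_num

/-- Pointwise form of the union bound over pairs: the weight j counts the indices below j. -/
lemma sum_index_above_level_le {p : ℝ} (hp : 0 < p) (a : ℝ) (N : ℕ) :
    ∑ j ∈ Finset.range N, (if level p j < |a| then (j : ℝ) else 0) ≤ |a| ^ p := by
  simp only [level_lt_iff hp]
  exact (sum_nat_head_le (by positivity) N).trans (rpow_half_sq p a).le

/-- The summand is at most |a| (j+1)^(1-2/p), whose exponent exceeds -1 exactly because p > 1. This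
is the estimate that fails at p = 1. -/
lemma sum_div_level_above_level_le {p : ℝ} (hp1 : 1 < p) (hp2 : p < 2) (a : ℝ) (N : ℕ) :
    ∑ j ∈ Finset.range N, (if level p j < |a| then (j : ℝ) * (|a| / level p j) else 0) ≤
      (2 - 2 / p)⁻¹ * |a| ^ p := by
  have hp : 0 < p := by linarith
  have hr : 0 < 2 - 2 / p := by rw [sub_pos, div_lt_iff₀ hp]; linarith
  have hr1 : 2 - 2 / p ≤ 1 := by
    have : 1 ≤ 2 / p := by rw [le_div_iff₀ hp]; linarith
    linarith
  simp only [level_lt_iff hp]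
  rcases (abs_nonneg a).eq_or_lt with ha | ha
  · rw [← ha]
    simp
    positivity
  calc _ ≤ ∑ j ∈ Finset.range N, |a| * (if (j : ℝ) + 1 < |a| ^ (p / 2) then
        ((j : ℝ) + 1) ^ ((2 - 2 / p) - 1) else 0) := by
        refine Finset.sum_le_sum fun j _ => ?_
        split_ifs
        · unfold level
          have hj : (0 : ℝ) < (j : ℝ) + 1 := by positivity
          rw [show 2 - 2 / p - 1 = 1 - 2 / p by ring, Real.rpow_sub hj, Real.rpow_one, mul_div_left_comm]
          gcongr
          linarith
        · simp
    _ ≤ |a| * ((2 - 2 / p)⁻¹ * (|a| ^ (p / 2)) ^ (2 - 2 / p)) := by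
        rw [← Finset.mul_sum]
        gcongr
        exact sum_rpow_head_le hr hr1 (by positivity) N
    _ = (2 - 2 / p)⁻¹ * (|a| ^ (1 : ℝ) * |a| ^ (p / 2 * (2 - 2 / p))) := by
        rw [← Real.rpow_mul ha.le, Real.rpow_one]; ring
    _ = _ := by
        rw [← Real.rpow_add ha]
        congr 2
        field_simp
        ring

/-- Here j / (level j)² ≤ (j+1)^(1-4/p), and p < 2 makes this summable, with a tail that turns a²
into |a|^p. -/
lemma sum_sq_div_level_below_level_le {p : ℝ} (hp0 : 0 < p) (hp2 : p < 2) (a : ℝ) (N : ℕ) :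
    ∑ j ∈ Finset.range N, (if |a| ≤ level p j then (j : ℝ) * (a ^ 2 / level p j ^ 2) else 0) ≤
      (4 / p) / (4 / p - 2) * |a| ^ p := by
  have hq : 0 < 4 / p - 2 := by rw [sub_pos, lt_div_iff₀ hp0]; linarith
  rcases (abs_nonneg a).eq_or_lt with ha | ha
  · rw [← ha, abs_eq_zero.1 ha.symm]
    simp
    positivity
  have hle : ∀ j : ℕ, |a| ≤ level p j ↔ |a| ^ (p / 2) ≤ (j : ℝ) + 1 := fun j => by
    rw [← not_lt, level_lt_iff hp0, not_lt]
  simp only [hle]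
  set t := |a| ^ (p / 2) with ht
  have ht0 : 0 < t := by positivity
  have hat : a ^ 2 = t ^ (4 / p) := by
    rw [ht, ← Real.rpow_mul ha.le, show p / 2 * (4 / p) = (2 : ℕ) by field_simp; norm_num,
      Real.rpow_natCast, sq_abs]
  calc _ ≤ ∑ j ∈ Finset.range N, a ^ 2 * (if t ≤ (j : ℝ) + 1 then
        ((j : ℝ) + 1) ^ (-(1 + (4 / p - 2))) else 0) := by
        refine Finset.sum_le_sum fun j _ => ?_
        split_ifs
        · unfold level
          have hj : (0 : ℝ) < (j : ℝ) + 1 := by positivity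
          rw [show -(1 + (4 / p - 2)) = 1 - 2 / p * (2 : ℕ) by push_cast; ring, Real.rpow_sub hj,
            Real.rpow_one, mul_div_left_comm, Real.rpow_mul hj.le, Real.rpow_natCast]
          gcongr
          linarith
        · simp
    _ ≤ a ^ 2 * ((2 + (4 / p - 2)) / (4 / p - 2) * (max 1 t) ^ (-(4 / p - 2))) := by
        rw [← Finset.mul_sum]
        gcongr
        exact sum_rpow_tail_le hq t N
    _ = (4 / p) / (4 / p - 2) * (t ^ (4 / p) * (max 1 t) ^ (-(4 / p - 2))) := by
        rw [hat]; ring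
    _ ≤ (4 / p) / (4 / p - 2) * t ^ (2 : ℕ) := by
        gcongr
        rcases le_total 1 t with h | h
        · rw [max_eq_right h, ← Real.rpow_add ht0, ← Real.rpow_natCast]
          apply le_of_eq
          congr 1
          push_cast; ring
        · rw [max_eq_left h, Real.one_rpow, mul_one, ← Real.rpow_natCast]
          apply Real.rpow_le_rpow_of_exponent_ge ht0 h
          push_cast; linarith
    _ = _ := by rw [ht, rpow_half_sq]

lemma tsum_ofReal_le {f : ℕ → ℝ} (hf : ∀ j, 0 ≤ f j) {B : ℝ}
    (h : ∀ N, ∑ j ∈ Finset.range N, f j ≤ B) :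
    ∑' j, ENNReal.ofReal (f j) ≤ ENNReal.ofReal B := by
  refine ENNReal.tsum_le_of_sum_range_le fun N => ?_
  rw [← ENNReal.ofReal_sum_of_nonneg fun j _ => hf j]
  exact ENNReal.ofReal_le_ofReal (h N)

/-! ### Maximal inequalities for bounded martingale differences. -/

/-- Bounded martingale differences `d j`, measurable with respect to `F (j + 1)` and
orthogonal to every bounded `F j`-measurable function. -/
structure IsBoundedMartingaleDiff {Ω : Type*} {m : MeasurableSpace Ω} (F : Filtration ℕ m)
    (μ : Measure Ω) (d : ℕ → Ω → ℝ) : Prop where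
  meas : ∀ j, StronglyMeasurable[F (j + 1)] (d j)
  bdd : ∀ j, ∃ C, ∀ ω, |d j ω| ≤ C
  orth : ∀ j (G : Ω → ℝ), StronglyMeasurable[F j] G → (∃ C, ∀ ω, |G ω| ≤ C) →
    ∫ ω, G ω * d j ω ∂μ = 0

namespace IsBoundedMartingaleDiff

variable {Ω : Type*} {m : MeasurableSpace Ω} {F : Filtration ℕ m} {μ : Measure Ω}
  {d : ℕ → Ω → ℝ}

lemma const_mul (h : IsBoundedMartingaleDiff F μ d) (a : ℕ → ℝ) :
    IsBoundedMartingaleDiff F μ (fun j ω => a j * d j ω) where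
  meas j := (h.meas j).const_mul (a j)
  bdd j := by
    obtain ⟨C, hC⟩ := h.bdd j
    exact ⟨|a j| * C, fun ω => by rw [abs_mul]; gcongr; exact hC ω⟩
  orth j G hG hGb := by
    simp_rw [mul_left_comm _ (a j)]
    rw [integral_const_mul, h.orth j G hG hGb, mul_zero]

lemma sum_bdd (h : IsBoundedMartingaleDiff F μ d) (n : ℕ) :
    ∃ C, ∀ ω, |∑ j ∈ Finset.range n, d j ω| ≤ C := by
  choose C hC using h.bdd
  exact ⟨∑ j ∈ Finset.range n, C j, fun ω =>
    (Finset.abs_sum_le_sum_abs _ _).trans (Finset.sum_le_sum fun j _ => hC j ω)⟩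

lemma sum_meas (h : IsBoundedMartingaleDiff F μ d) (n : ℕ) :
    StronglyMeasurable[F n] (fun ω => ∑ j ∈ Finset.range n, d j ω) :=
  Finset.stronglyMeasurable_fun_sum _ fun j hj =>
    (h.meas j).mono (F.mono (Finset.mem_range.1 hj))

lemma _root_.integrable_of_abs_le [IsFiniteMeasure μ] {f : Ω → ℝ} (hf : StronglyMeasurable f)
    (hb : ∃ C, ∀ ω, |f ω| ≤ C) : Integrable f μ := by
  obtain ⟨C, hC⟩ := hb
  exact Integrable.of_bound hf.aestronglyMeasurable C (ae_of_all _ hC)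

lemma setIntegral_sq_succ [IsFiniteMeasure μ] (h : IsBoundedMartingaleDiff F μ d) (n : ℕ)
    {s : Set Ω} (hs : MeasurableSet[F n] s) :
    ∫ ω in s, (∑ j ∈ Finset.range (n + 1), d j ω) ^ 2 ∂μ =
      ∫ ω in s, (∑ j ∈ Finset.range n, d j ω) ^ 2 ∂μ + ∫ ω in s, d n ω ^ 2 ∂μ := by
  have hs' := F.le n s hs
  obtain ⟨C, hC⟩ := h.sum_bdd n
  obtain ⟨D, hD⟩ := h.bdd n
  have hT := (h.sum_meas n).mono (F.le n)
  have hd := (h.meas n).mono (F.le (n + 1))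
  have i1 : Integrable (fun ω => (∑ j ∈ Finset.range n, d j ω) ^ 2) μ :=
    integrable_of_abs_le (hT.pow 2) ⟨C ^ 2, fun ω => by rw [abs_pow]; gcongr; exact hC ω⟩
  have i2 : Integrable (fun ω => d n ω ^ 2) μ :=
    integrable_of_abs_le (hd.pow 2) ⟨D ^ 2, fun ω => by rw [abs_pow]; gcongr; exact hD ω⟩
  have i3 : Integrable (fun ω => 2 * ((∑ j ∈ Finset.range n, d j ω) * d n ω)) μ := by
    refine (integrable_of_abs_le (hT.mul hd) ⟨C * D, fun ω => ?_⟩).const_mul 2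
    rw [Pi.mul_apply, abs_mul]
    exact mul_le_mul (hC ω) (hD ω) (abs_nonneg _) ((abs_nonneg _).trans (hC ω))
  have hcross : ∫ ω in s, 2 * ((∑ j ∈ Finset.range n, d j ω) * d n ω) ∂μ = 0 := by
    rw [integral_const_mul, ← integral_indicator hs']
    -- The partial sum cut off to `s` is a bounded `F n`-measurable test function, so orthogonality
    -- removes the cross term.
    have := h.orth n (s.indicator fun ω => ∑ j ∈ Finset.range n, d j ω)
      ((h.sum_meas n).indicator hs) ⟨C, fun ω => by
        by_cases hω : ω ∈ s
        · simpa [hω] using hC ω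
        · simpa [hω] using (abs_nonneg _).trans (hC ω)⟩
    simp_rw [← Set.indicator_mul_left] at this
    rw [this, mul_zero]
  have hexp : ∀ ω, (∑ j ∈ Finset.range (n + 1), d j ω) ^ 2 =
      (∑ j ∈ Finset.range n, d j ω) ^ 2 + 2 * ((∑ j ∈ Finset.range n, d j ω) * d n ω) +
        d n ω ^ 2 := fun ω => by rw [Finset.sum_range_succ]; ring
  simp_rw [hexp]
  have e1 := integral_add (i1.add i3).integrableOn (i2.integrableOn (s := s))
  have e2 := integral_add (i1.integrableOn (s := s)) (i3.integrableOn (s := s))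
  simp only [Pi.add_apply] at e1
  rw [e1, e2, hcross, add_zero]

lemma submartingale_sq [IsFiniteMeasure μ] (h : IsBoundedMartingaleDiff F μ d) :
    Submartingale (fun n ω => (∑ j ∈ Finset.range n, d j ω) ^ 2) F μ := by
  refine submartingale_of_setIntegral_le_succ (fun n => (h.sum_meas n).pow 2) (fun n => ?_)
    fun n s hs => ?_
  · obtain ⟨C, hC⟩ := h.sum_bdd n
    exact integrable_of_abs_le (((h.sum_meas n).mono (F.le n)).pow 2)
      ⟨C ^ 2, fun ω => by rw [abs_pow]; gcongr; exact hC ω⟩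
  · rw [h.setIntegral_sq_succ n hs]
    exact le_add_of_nonneg_right (integral_nonneg fun ω => sq_nonneg _)

lemma integral_sq_sum [IsFiniteMeasure μ] (h : IsBoundedMartingaleDiff F μ d) (n : ℕ) :
    ∫ ω, (∑ j ∈ Finset.range n, d j ω) ^ 2 ∂μ = ∑ j ∈ Finset.range n, ∫ ω, d j ω ^ 2 ∂μ := by
  induction n with
  | zero => simp
  | succ n ih =>
    have := h.setIntegral_sq_succ n (MeasurableSet.univ)
    simp only [setIntegral_univ] at this
    rw [this, ih, Finset.sum_range_succ]

/-- Doob's inequality for the submartingale of squares, followed by continuity of the measure along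
increasing time horizons. -/
lemma measure_exists_lt_abs_sum_le [IsFiniteMeasure μ] (h : IsBoundedMartingaleDiff F μ d)
    {c : ℝ} (hc : 0 < c) :
    μ {ω | ∃ n, c < |∑ j ∈ Finset.range n, d j ω|} ≤
      ∑' j, ENNReal.ofReal ((∫ ω, d j ω ^ 2 ∂μ) / c ^ 2) := by
  have hset : {ω | ∃ n, c < |∑ j ∈ Finset.range n, d j ω|} =
      ⋃ N : ℕ, {ω | ∃ n ≤ N, c < |∑ j ∈ Finset.range n, d j ω|} := by
    ext ω
    simp only [Set.mem_ofPred_eq, Set.mem_iUnion]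
    exact ⟨fun ⟨n, hn⟩ => ⟨n, n, le_rfl, hn⟩, fun ⟨_, n, _, hn⟩ => ⟨n, hn⟩⟩
  have hmono : Monotone fun N : ℕ => {ω | ∃ n ≤ N, c < |∑ j ∈ Finset.range n, d j ω|} := by
    rintro N N' hN ω ⟨n, hn, h'⟩
    exact ⟨n, hn.trans hN, h'⟩
  rw [hset, hmono.measure_iUnion]
  refine iSup_le fun N => ?_
  have hdoob := maximal_ineq h.submartingale_sq (fun n ω => sq_nonneg _)
    (ε := Real.toNNReal (c ^ 2)) N
  change ENNReal.ofReal (c ^ 2) * _ ≤ _ at hdoob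
  rw [Real.coe_toNNReal _ (sq_nonneg c)] at hdoob
  have hint : Integrable (fun ω => (∑ j ∈ Finset.range N, d j ω) ^ 2) μ :=
    h.submartingale_sq.integrable N
  have h1 : ENNReal.ofReal (c ^ 2) * μ {ω | ∃ n ≤ N, c < |∑ j ∈ Finset.range n, d j ω|} ≤
      ENNReal.ofReal (∑ j ∈ Finset.range N, ∫ ω, d j ω ^ 2 ∂μ) := by
    refine le_trans ?_ (hdoob.trans (ENNReal.ofReal_le_ofReal ?_))
    · gcongr
      rintro ⟨n, hn, hlt⟩
      refine Finset.le_sup'_of_le _ (Finset.mem_range.2 (Nat.lt_succ_of_le hn)) ?_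
      rw [← sq_abs (∑ j ∈ Finset.range n, d j ω)]
      gcongr
    · rw [← h.integral_sq_sum N]
      exact setIntegral_le_integral hint (ae_of_all _ fun ω => sq_nonneg _)
  have hcpos : 0 < ENNReal.ofReal (c ^ 2) := by rw [ENNReal.ofReal_pos]; positivity
  rw [mul_comm, ← ENNReal.le_div_iff_mul_le (Or.inl hcpos.ne') (Or.inl ENNReal.ofReal_ne_top),
    ← ENNReal.ofReal_div_of_pos (by positivity), Finset.sum_div,
    ENNReal.ofReal_sum_of_nonneg fun j _ => div_nonneg (integral_nonneg fun ω => sq_nonneg _)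
      (sq_nonneg _)] at h1
  exact h1.trans (ENNReal.sum_le_tsum _)

/-- Abel summation, as in Kronecker's lemma: bounds on the weighted sums transfer to the unweighted
ones. -/
lemma _root_.abs_sum_le_of_weighted {b s : ℕ → ℝ} (hb : ∀ n, 0 < b n) (hmono : Monotone b) {c : ℝ}
    (h : ∀ n, |∑ j ∈ Finset.range n, (b j)⁻¹ * s j| ≤ c) (n : ℕ) :
    |∑ j ∈ Finset.range (n + 1), s j| ≤ 2 * c * b n := by
  set T : ℕ → ℝ := fun n => ∑ j ∈ Finset.range n, (b j)⁻¹ * s j with hT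
  have hTs : ∀ n, T (n + 1) = T n + (b n)⁻¹ * s n := fun n => Finset.sum_range_succ _ _
  have hc : 0 ≤ c := (abs_nonneg _).trans (h 0)
  -- The difference is a sum of terms (b(k+1) - b(k)) T(k+1), and the nonnegative increments of `b`
  -- telescope.
  have key : ∀ n, |(∑ j ∈ Finset.range (n + 1), s j) - b n * T (n + 1)| ≤ (b n - b 0) * c := by
    intro n
    induction n with
    | zero =>
      have : b 0 ≠ 0 := (hb 0).ne'
      simp [hT, this]
    | succ n ih =>
      have hne : b (n + 1) ≠ 0 := (hb _).ne'
      have e : (∑ j ∈ Finset.range (n + 1 + 1), s j) - b (n + 1) * T (n + 1 + 1) =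
          ((∑ j ∈ Finset.range (n + 1), s j) - b n * T (n + 1)) +
            -((b (n + 1) - b n) * T (n + 1)) := by
        rw [Finset.sum_range_succ, hTs (n + 1)]
        field_simp
        ring
      rw [e]
      refine (abs_add_le _ _).trans ?_
      have hbn : 0 ≤ b (n + 1) - b n := sub_nonneg.2 (hmono n.le_succ)
      rw [abs_neg, abs_mul, abs_of_nonneg hbn]
      have := mul_le_mul_of_nonneg_left (h (n + 1)) hbn
      linarith
  have h1 : |b n * T (n + 1)| ≤ b n * c := by
    rw [abs_mul, abs_of_pos (hb n)]
    exact mul_le_mul_of_nonneg_left (h (n + 1)) (hb n).le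
  have h2 := abs_sub_abs_le_abs_sub (∑ j ∈ Finset.range (n + 1), s j) (b n * T (n + 1))
  have h3 := key n
  have h4 : 0 ≤ b 0 * c := mul_nonneg (hb 0).le hc
  linarith

/-- Weighted maximal inequality of Hájek–Rényi type. -/
lemma measure_exists_half_lt_abs_sum_le [IsFiniteMeasure μ] (h : IsBoundedMartingaleDiff F μ d)
    {b : ℕ → ℝ} (hb : ∀ n, 0 < b n) (hmono : Monotone b) :
    μ {ω | ∃ n, b n / 2 < |∑ j ∈ Finset.range (n + 1), d j ω|} ≤
      ∑' j, ENNReal.ofReal (16 * ((∫ ω, d j ω ^ 2 ∂μ) / b j ^ 2)) := by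
  -- Abel summation doubles the bound, so 1/4 yields the threshold `b n / 2`; 16 is (1/4)⁻².
  have h1 := (h.const_mul fun j => (b j)⁻¹).measure_exists_lt_abs_sum_le
    (show (0 : ℝ) < 1 / 4 by norm_num)
  refine (measure_mono ?_).trans (h1.trans_eq ?_)
  · rintro ω ⟨n, hn⟩
    by_contra hcon
    simp only [Set.mem_ofPred_eq, not_exists, not_lt] at hcon
    have := abs_sum_le_of_weighted hb hmono hcon n
    linarith
  · congr 1
    ext j
    congr 1
    simp_rw [mul_pow]
    rw [integral_const_mul]
    have := (hb j).ne'
    field_simp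
    norm_num

end IsBoundedMartingaleDiff

/-! ### Hoeffding decomposition of a kernel. -/

section Degenerate

variable {E : Type*} [MeasurableSpace E] {ν : Measure E} {k : E → E → ℝ}

/-- The first projection `x ↦ ∫ k x y dν(y)` of a kernel. -/
noncomputable def proj (ν : Measure E) (k : E → E → ℝ) (x : E) : ℝ := ∫ y, k x y ∂ν

/-- The completely degenerate part of a symmetric kernel in its Hoeffding decomposition. -/
noncomputable def degPart (ν : Measure E) (k : E → E → ℝ) (x y : E) : ℝ :=
  k x y - proj ν k x - proj ν k y + ∫ z, proj ν k z ∂ν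

lemma measurable_section (hk : Measurable (Function.uncurry k)) (x : E) : Measurable (k x) :=
  hk.comp measurable_prodMk_left

lemma degPart_symm (hsymm : ∀ x y, k x y = k y x) (x y : E) :
    degPart ν k x y = degPart ν k y x := by
  unfold degPart; rw [hsymm x y]; ring

variable [IsProbabilityMeasure ν]

lemma measurable_proj (hk : Measurable (Function.uncurry k)) : Measurable (proj ν k) :=
  (hk.stronglyMeasurable.integral_prod_right (ν := ν)).measurable

lemma measurable_degPart (hk : Measurable (Function.uncurry k)) :
    Measurable (Function.uncurry (degPart ν k)) := by
  have hp := measurable_proj (ν := ν) hk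
  have hk' : Measurable fun z : E × E => k z.1 z.2 := hk
  have : Measurable fun z : E × E => degPart ν k z.1 z.2 := by unfold degPart; fun_prop
  exact this

lemma abs_integral_le_of_abs_le {f : E → ℝ} {C : ℝ} (hf : ∀ x, |f x| ≤ C) :
    |∫ x, f x ∂ν| ≤ C := by
  have := norm_integral_le_of_norm_le_const (μ := ν) (f := f) (C := C) (ae_of_all _ hf)
  simpa using this

lemma abs_proj_le {C : ℝ} (hC : ∀ x y, |k x y| ≤ C) (x : E) : |proj ν k x| ≤ C :=
  abs_integral_le_of_abs_le (hC x)

lemma abs_degPart_le {C : ℝ} (hC : ∀ x y, |k x y| ≤ C) (x y : E) : |degPart ν k x y| ≤ 4 * C := by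
  have h1 := abs_le.1 (hC x y)
  have h2 := abs_le.1 (abs_proj_le (ν := ν) hC x)
  have h3 := abs_le.1 (abs_proj_le (ν := ν) hC y)
  have h4 := abs_le.1 (abs_integral_le_of_abs_le (ν := ν) (abs_proj_le (ν := ν) hC))
  unfold degPart
  rw [abs_le]
  constructor <;> linarith

lemma integral_degPart {C : ℝ} (hk : Measurable (Function.uncurry k)) (hC : ∀ x y, |k x y| ≤ C)
    (x : E) : ∫ y, degPart ν k x y ∂ν = 0 := by
  have h1 : Integrable (k x) ν :=
    integrable_of_abs_le (measurable_section hk x).stronglyMeasurable ⟨C, hC x⟩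
  have h2 : Integrable (proj ν k) ν :=
    integrable_of_abs_le (measurable_proj hk).stronglyMeasurable ⟨C, abs_proj_le hC⟩
  have e : ∀ y, degPart ν k x y = (k x y - proj ν k y) + (∫ z, proj ν k z ∂ν - proj ν k x) :=
    fun y => by unfold degPart; ring
  have e1 := integral_add (h1.sub h2) (integrable_const (μ := ν) (∫ z, proj ν k z ∂ν - proj ν k x))
  simp only [Pi.sub_apply] at e1
  simp_rw [e]
  rw [e1, integral_sub h1 h2]
  simp [proj]

lemma ofReal_abs_rpow {q : ℝ} (hq : 0 ≤ q) (a : ℝ) : ENNReal.ofReal (|a| ^ q) = ‖a‖ₑ ^ q := by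
  rw [← ENNReal.ofReal_rpow_of_nonneg (abs_nonneg a) hq, Real.enorm_eq_ofReal_abs]

lemma rpow_lintegral_enorm_le {q : ℝ} (hq : 1 ≤ q) {f : E → ℝ} (hf : Measurable f) :
    (∫⁻ x, ‖f x‖ₑ ∂ν) ^ q ≤ ∫⁻ x, ‖f x‖ₑ ^ q ∂ν := by
  have := eLpNorm'_le_eLpNorm'_of_exponent_le (μ := ν) zero_lt_one hq hf.aestronglyMeasurable
  simp only [eLpNorm', ENNReal.rpow_one, div_one] at this
  have h := ENNReal.rpow_le_rpow this (show 0 ≤ q by linarith)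
  rwa [← ENNReal.rpow_mul, one_div, inv_mul_cancel₀ (by linarith), ENNReal.rpow_one] at h

lemma lintegral_proj_rpow_le {q : ℝ} (hq : 1 ≤ q) (hk : Measurable (Function.uncurry k)) :
    ∫⁻ x, ‖proj ν k x‖ₑ ^ q ∂ν ≤ ∫⁻ z, ‖k z.1 z.2‖ₑ ^ q ∂(ν.prod ν) := by
  have hm : Measurable fun z : E × E => ‖k z.1 z.2‖ₑ ^ q := by
    have : Measurable fun z : E × E => k z.1 z.2 := hk
    fun_prop
  rw [lintegral_prod _ hm.aemeasurable]
  refine lintegral_mono fun x => ?_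
  refine le_trans ?_ (rpow_lintegral_enorm_le hq (measurable_section hk x))
  gcongr
  exact enorm_integral_le_lintegral_enorm _

/-- Four times the largest term dominates the sum; this needs no convexity of the power. -/
lemma enorm_add_four_rpow_le {q : ℝ} (hq : 0 ≤ q) (a b c d : ℝ) :
    ‖a - b - c + d‖ₑ ^ q ≤
      4 ^ q * (‖a‖ₑ ^ q + ‖b‖ₑ ^ q + ‖c‖ₑ ^ q + ‖d‖ₑ ^ q) := by
  set m := max (max ‖a‖ₑ ‖b‖ₑ) (max ‖c‖ₑ ‖d‖ₑ) with hm
  have h1 : ‖a - b - c + d‖ₑ ≤ 4 * m := by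
    calc _ ≤ ‖a‖ₑ + ‖b‖ₑ + ‖c‖ₑ + ‖d‖ₑ := by
          refine (enorm_add_le _ _).trans ?_
          gcongr
          refine enorm_sub_le.trans ?_
          gcongr
          exact enorm_sub_le
      _ ≤ m + m + m + m := by
          gcongr <;> simp [hm]
      _ = 4 * m := by ring
  calc _ ≤ (4 * m) ^ q := by gcongr
    _ = 4 ^ q * m ^ q := ENNReal.mul_rpow_of_nonneg _ _ hq
    _ ≤ _ := by
      gcongr
      have hmono : Monotone fun x : ℝ≥0∞ => x ^ q := ENNReal.monotone_rpow_of_nonneg hq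
      have e : m ^ q = max (max (‖a‖ₑ ^ q) (‖b‖ₑ ^ q)) (max (‖c‖ₑ ^ q) (‖d‖ₑ ^ q)) := by
        rw [hm]
        rw [show (max (max ‖a‖ₑ ‖b‖ₑ) (max ‖c‖ₑ ‖d‖ₑ)) ^ q = _ from hmono.map_max,
          show (max ‖a‖ₑ ‖b‖ₑ) ^ q = _ from hmono.map_max,
          show (max ‖c‖ₑ ‖d‖ₑ) ^ q = _ from hmono.map_max]
      rw [e, add_assoc]
      refine max_le_add_of_nonneg (by positivity) (by positivity) |>.trans ?_
      gcongr
      · exact max_le_add_of_nonneg (by positivity) (by positivity)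
      · exact max_le_add_of_nonneg (by positivity) (by positivity)

/-- By Jensen's inequality, each of the four terms of `degPart` has q-th moment at most that of `k`.
-/
lemma lintegral_degPart_rpow_le {q : ℝ} (hq : 1 ≤ q) (hk : Measurable (Function.uncurry k)) :
    ∫⁻ z, ‖degPart ν k z.1 z.2‖ₑ ^ q ∂(ν.prod ν) ≤
      4 ^ q * 4 * ∫⁻ z, ‖k z.1 z.2‖ₑ ^ q ∂(ν.prod ν) := by
  have hq0 : 0 ≤ q := by linarith
  have hk' : Measurable fun z : E × E => k z.1 z.2 := hk
  have hp := measurable_proj (ν := ν) hk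
  set I := ∫⁻ z, ‖k z.1 z.2‖ₑ ^ q ∂(ν.prod ν) with hI
  have hP : ∫⁻ x, ‖proj ν k x‖ₑ ^ q ∂ν ≤ I := lintegral_proj_rpow_le hq hk
  have h4 : ‖∫ z, proj ν k z ∂ν‖ₑ ^ q ≤ I := by
    refine le_trans ?_ ((rpow_lintegral_enorm_le hq hp).trans hP)
    gcongr
    exact enorm_integral_le_lintegral_enorm _
  have hf : ∫⁻ z : E × E, ‖proj ν k z.1‖ₑ ^ q ∂(ν.prod ν) ≤ I := by
    have := measurePreserving_fst (μ := ν) (ν := ν) |>.lintegral_comp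
      (f := fun x => ‖proj ν k x‖ₑ ^ q) (by fun_prop)
    exact this.trans_le hP
  have hs : ∫⁻ z : E × E, ‖proj ν k z.2‖ₑ ^ q ∂(ν.prod ν) ≤ I := by
    have := measurePreserving_snd (μ := ν) (ν := ν) |>.lintegral_comp
      (f := fun x => ‖proj ν k x‖ₑ ^ q) (by fun_prop)
    exact this.trans_le hP
  calc _ ≤ ∫⁻ z, 4 ^ q * (‖k z.1 z.2‖ₑ ^ q + ‖proj ν k z.1‖ₑ ^ q + ‖proj ν k z.2‖ₑ ^ q +
        ‖∫ z, proj ν k z ∂ν‖ₑ ^ q) ∂(ν.prod ν) :=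
        lintegral_mono fun z => enorm_add_four_rpow_le hq0 _ _ _ _
    _ ≤ 4 ^ q * (I + I + I + I) := by
        rw [lintegral_const_mul _ (by fun_prop), lintegral_add_left (by fun_prop),
          lintegral_add_left (by fun_prop), lintegral_add_left (by fun_prop)]
        gcongr
        simpa using h4
    _ = _ := by ring

end Degenerate

/-! ### Independence, filtration and second moments. -/

/-- `X` is a sequence of independent random variables with common law `ν`. -/
structure IsIIDWithLaw {Ω E : Type*} [MeasurableSpace Ω] [MeasurableSpace E]
    (X : ℕ → Ω → E) (μ : Measure Ω) (ν : Measure E) : Prop where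
  meas : ∀ i, Measurable (X i)
  indep : iIndepFun X μ
  law : ∀ i, μ.map (X i) = ν

namespace IsIIDWithLaw

variable {Ω E : Type*} [mΩ : MeasurableSpace Ω] [MeasurableSpace E]
    {X : ℕ → Ω → E} {μ : Measure Ω} {ν : Measure E}

/-- The first `n` values of the sequence. -/
def history (X : ℕ → Ω → E) (n : ℕ) (ω : Ω) (i : Finset.range n) : E := X i ω

lemma measurable_history (h : ∀ i, Measurable (X i)) (n : ℕ) : Measurable (history X n) :=
  measurable_pi_lambda _ fun i => h i

/-- The filtration generated by the sequence. -/
def filtration (h : ∀ i, Measurable (X i)) : Filtration ℕ mΩ where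
  seq n := MeasurableSpace.comap (history X n) inferInstance
  mono' := by
    intro n n' hn
    have hr : Measurable fun (x : Finset.range n' → E) (i : Finset.range n) =>
        x ⟨i, Finset.mem_range.2 ((Finset.mem_range.1 i.2).trans_le hn)⟩ :=
      measurable_pi_lambda _ fun i => measurable_pi_apply _
    have e : history X n = (fun (x : Finset.range n' → E) (i : Finset.range n) =>
        x ⟨i, Finset.mem_range.2 ((Finset.mem_range.1 i.2).trans_le hn)⟩) ∘ history X n' := rfl
    change MeasurableSpace.comap (history X n) _ ≤ MeasurableSpace.comap (history X n') _
    rw [e, ← MeasurableSpace.comap_comp]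
    exact MeasurableSpace.comap_mono hr.comap_le
  le' n := (measurable_history h n).comap_le

lemma integral_eq_zero_of_indepFun [IsProbabilityMeasure μ] [IsProbabilityMeasure ν]
    {F : Type*} [MeasurableSpace F] {Y : Ω → F} {Z : Ω → E} (hY : Measurable Y)
    (hZ : Measurable Z) (hYZ : IndepFun Y Z μ) (hlaw : μ.map Z = ν) {ψ : F → E → ℝ}
    (hψ : Measurable (Function.uncurry ψ)) (h0 : ∀ y, ∫ z, ψ y z ∂ν = 0) :
    ∫ ω, ψ (Y ω) (Z ω) ∂μ = 0 := by
  have hmap := hYZ.map_prod_eq_prod_map_map hY.aemeasurable hZ.aemeasurable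
  have hYp : IsProbabilityMeasure (μ.map Y) := Measure.isProbabilityMeasure_map hY.aemeasurable
  have e : ∫ ω, ψ (Y ω) (Z ω) ∂μ = ∫ q, Function.uncurry ψ q ∂((μ.map Y).prod ν) := by
    rw [← hlaw, ← hmap, integral_map (hY.prodMk hZ).aemeasurable hψ.aestronglyMeasurable]
    rfl
  rw [e]
  by_cases hi : Integrable (Function.uncurry ψ) ((μ.map Y).prod ν)
  · rw [integral_prod _ hi]
    simp [h0]
  -- The Bochner integral of a non-integrable function is 0 by convention.
  · exact integral_undef hi

lemma map_pair (hX : IsIIDWithLaw X μ ν) [IsProbabilityMeasure μ] {i j : ℕ} (hij : i ≠ j) :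
    μ.map (fun ω => (X i ω, X j ω)) = ν.prod ν := by
  have := (hX.indep.indepFun hij).map_prod_eq_prod_map_map (hX.meas i).aemeasurable
    (hX.meas j).aemeasurable
  rw [this, hX.law, hX.law]

lemma lintegral_pair (hX : IsIIDWithLaw X μ ν) [IsProbabilityMeasure μ] {i j : ℕ} (hij : i ≠ j)
    {f : E × E → ℝ≥0∞} (hf : Measurable f) :
    ∫⁻ ω, f (X i ω, X j ω) ∂μ = ∫⁻ z, f z ∂(ν.prod ν) := by
  rw [← hX.map_pair hij, lintegral_map hf ((hX.meas i).prodMk (hX.meas j))]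

lemma integral_pair (hX : IsIIDWithLaw X μ ν) [IsProbabilityMeasure μ] {i j : ℕ} (hij : i ≠ j)
    {f : E × E → ℝ} (hf : Measurable f) :
    ∫ ω, f (X i ω, X j ω) ∂μ = ∫ z, f z ∂(ν.prod ν) := by
  rw [← hX.map_pair hij, integral_map ((hX.meas i).prodMk (hX.meas j)).aemeasurable
    hf.aestronglyMeasurable]

lemma lintegral_single (hX : IsIIDWithLaw X μ ν) (i : ℕ) {f : E → ℝ≥0∞} (hf : Measurable f) :
    ∫⁻ ω, f (X i ω) ∂μ = ∫⁻ x, f x ∂ν := by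
  rw [← hX.law i, lintegral_map hf (hX.meas i)]

lemma indepFun_history (hX : IsIIDWithLaw X μ ν) [IsProbabilityMeasure μ] (n : ℕ) :
    IndepFun (history X n) (X n) μ := by
  have h := hX.indep.indepFun_finset (Finset.range n) {n} (by simp) hX.meas
  exact h.comp (ψ := fun f : ({n} : Finset ℕ) → E => f ⟨n, Finset.mem_singleton_self n⟩)
    measurable_id (measurable_pi_apply _)

lemma isBoundedMartingaleDiff (hX : IsIIDWithLaw X μ ν) [IsProbabilityMeasure μ]
    [IsProbabilityMeasure ν] (Ψ : (n : ℕ) → (Finset.range n → E) → E → ℝ)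
    (hΨ : ∀ n, Measurable (Function.uncurry (Ψ n))) (hb : ∀ n, ∃ C, ∀ y z, |Ψ n y z| ≤ C)
    (h0 : ∀ n y, ∫ z, Ψ n y z ∂ν = 0) :
    IsBoundedMartingaleDiff (filtration hX.meas) μ
      (fun n ω => Ψ n (history X n ω) (X n ω)) where
  meas n := by
    have hr : Measurable fun x : Finset.range (n + 1) → E =>
        ((fun i : Finset.range n => x ⟨i, Finset.mem_range.2
          ((Finset.mem_range.1 i.2).trans n.lt_succ_self)⟩), x ⟨n, by simp⟩) := by
      refine Measurable.prodMk (measurable_pi_lambda _ fun i => ?_) ?_ <;>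
      exact measurable_pi_apply _
    have h1 := (hΨ n).comp hr
    have h2 : Measurable[MeasurableSpace.comap (history X (n + 1)) inferInstance]
        (history X (n + 1)) := comap_measurable _
    exact (h1.comp h2).stronglyMeasurable
  bdd n := by
    obtain ⟨C, hC⟩ := hb n
    exact ⟨C, fun ω => hC _ _⟩
  orth n G hG _ := by
    -- Doob–Dynkin: the test function factors through the history, which is independent of `X n`.
    obtain ⟨g, hg, rfl⟩ := hG.measurable.exists_eq_measurable_comp
    refine integral_eq_zero_of_indepFun (measurable_history hX.meas n) (hX.meas n)
      (hX.indepFun_history n) (hX.law n) (ψ := fun y z => g y * Ψ n y z) ?_ fun y => ?_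
    · exact (hg.comp measurable_fst).mul (hΨ n)
    · rw [integral_const_mul, h0, mul_zero]

/-- Degeneracy makes distinct summands orthogonal, so the variance grows like j and not j². -/
lemma integral_sq_sum_pair (hX : IsIIDWithLaw X μ ν) [IsProbabilityMeasure μ]
    [IsProbabilityMeasure ν] {φ : E → E → ℝ} (hφ : Measurable (Function.uncurry φ))
    (hb : ∃ C, ∀ x y, |φ x y| ≤ C) (hsymm : ∀ x y, φ x y = φ y x)
    (h0 : ∀ x, ∫ y, φ x y ∂ν = 0) (j : ℕ) :
    ∫ ω, (∑ i ∈ Finset.range j, φ (X i ω) (X j ω)) ^ 2 ∂μ =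
      j * ∫ z, φ z.1 z.2 ^ 2 ∂(ν.prod ν) := by
  obtain ⟨C, hC⟩ := hb
  have hm : ∀ i, Measurable fun ω => φ (X i ω) (X j ω) := fun i =>
    hφ.comp ((hX.meas i).prodMk (hX.meas j))
  have hint : ∀ i i', Integrable (fun ω => φ (X i ω) (X j ω) * φ (X i' ω) (X j ω)) μ := fun i i' =>
    integrable_of_abs_le ((hm i).mul (hm i')).stronglyMeasurable ⟨C * C, fun ω => by
      rw [abs_mul]
      exact mul_le_mul (hC _ _) (hC _ _) (abs_nonneg _) ((abs_nonneg _).trans (hC (X i ω) (X j ω)))⟩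
  simp_rw [pow_two, Finset.sum_mul_sum]
  rw [integral_finsetSum _ fun i _ => integrable_finsetSum _ fun i' _ => hint i i']
  have hdiag : ∀ i ∈ Finset.range j, ∫ ω, ∑ i' ∈ Finset.range j,
      φ (X i ω) (X j ω) * φ (X i' ω) (X j ω) ∂μ = ∫ z, φ z.1 z.2 * φ z.1 z.2 ∂(ν.prod ν) := by
    intro i hi
    have hij : i ≠ j := (Finset.mem_range.1 hi).ne
    rw [integral_finsetSum _ fun i' _ => hint i i', Finset.sum_eq_single_of_mem i hi]
    · exact hX.integral_pair hij (f := fun z => φ z.1 z.2 * φ z.1 z.2) (hφ.mul hφ)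
    · intro i' hi' hne
      -- `X i'` is independent of the pair (`X i`, `X j`); with that pair frozen, the integral over
      -- `X i'` vanishes by symmetry and `h0`.
      refine integral_eq_zero_of_indepFun ((hX.meas i).prodMk (hX.meas j)) (hX.meas i')
        (hX.indep.indepFun_prodMk hX.meas i j i' hne.symm (Finset.mem_range.1 hi').ne')
        (hX.law i') (ψ := fun q z => φ q.1 q.2 * φ z q.2) ?_ fun q => ?_
      · exact (hφ.comp measurable_fst).mul
          (hφ.comp (measurable_snd.prodMk (measurable_snd.comp measurable_fst)))
      · simp_rw [integral_const_mul, hsymm _ q.2, h0, mul_zero]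
  rw [Finset.sum_congr rfl hdiag]
  simp

end IsIIDWithLaw

/-! ### Weak type maximal inequality for averages. -/

namespace IsIIDWithLaw

variable {Ω E : Type*} [mΩ : MeasurableSpace Ω] [MeasurableSpace E]
    {X : ℕ → Ω → E} {μ : Measure Ω} {ν : Measure E}

lemma integral_single (hX : IsIIDWithLaw X μ ν) (i : ℕ) {f : E → ℝ} (hf : Measurable f) :
    ∫ ω, f (X i ω) ∂μ = ∫ x, f x ∂ν := by
  rw [← hX.law i, integral_map (hX.meas i).aemeasurable hf.aestronglyMeasurable]

lemma sum_sq_div_below_le {a : ℝ} (ha : 0 ≤ a) (N : ℕ) :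
    ∑ j ∈ Finset.range N, (if a ≤ (j : ℝ) + 1 then a else 0) ^ 2 / ((j : ℝ) + 1) ^ 2 ≤ 3 * a := by
  have h := sum_rpow_tail_le (q := 1) one_pos a N
  have e : ∀ j : ℕ, (if a ≤ (j : ℝ) + 1 then a else 0) ^ 2 / ((j : ℝ) + 1) ^ 2 =
      a ^ 2 * (if a ≤ (j : ℝ) + 1 then ((j : ℝ) + 1) ^ (-(1 + 1 : ℝ)) else 0) := fun j => by
    have hj : (0 : ℝ) ≤ (j : ℝ) + 1 := by positivity
    split_ifs
    · rw [show (1 + 1 : ℝ) = (2 : ℕ) by norm_num, Real.rpow_neg hj, Real.rpow_natCast]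
      rfl
    · simp
  simp_rw [e]
  rw [← Finset.mul_sum]
  refine (mul_le_mul_of_nonneg_left h (sq_nonneg a)).trans ?_
  rw [Real.rpow_neg_one]
  rcases ha.eq_or_lt with rfl | ha
  · simp
  have hm : a ≤ max 1 a := le_max_right _ _
  have : (max 1 a)⁻¹ ≤ a⁻¹ := inv_anti₀ ha hm
  calc a ^ 2 * ((2 + 1) / 1 * (max 1 a)⁻¹) ≤ a ^ 2 * ((2 + 1) / 1 * a⁻¹) := by gcongr
    _ = 3 * a := by field_simp; norm_num

/-- Weak type maximal inequality for averages of a nonnegative i.i.d. sequence. -/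
lemma measure_exists_lt_sum_le (hX : IsIIDWithLaw X μ ν) [IsProbabilityMeasure μ]
    [IsProbabilityMeasure ν] {f : E → ℝ} (hf : Measurable f) (hf0 : ∀ x, 0 ≤ f x) :
    μ {ω | ∃ n : ℕ, (n : ℝ) + 1 < ∑ i ∈ Finset.range (n + 1), f (X i ω)} ≤
      49 * ∫⁻ x, ENNReal.ofReal (f x) ∂ν := by
  set J := ∫⁻ x, ENNReal.ofReal (f x) ∂ν with hJ
  -- A large `J` makes the bound trivial. Otherwise the truncated means are at most 1/2, so centring
  -- uses only half of the threshold.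
  by_cases hJ2 : 1 / 2 < J
  · calc _ ≤ (1 : ℝ≥0∞) := prob_le_one
      _ = 2 * (1 / 2) := by rw [ENNReal.mul_div_cancel] <;> norm_num
      _ ≤ 49 * J := by gcongr; norm_num
  rw [not_lt] at hJ2
  set g : ℕ → E → ℝ := fun j x => if f x ≤ (j : ℝ) + 1 then f x else 0 with hg
  have hgm : ∀ j, Measurable (g j) := fun j =>
    Measurable.ite (measurableSet_le hf measurable_const) hf measurable_const
  have hg0 : ∀ j x, 0 ≤ g j x := fun j x => by
    simp only [hg]; split_ifs; exacts [hf0 x, le_rfl]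
  have hgb : ∀ j x, |g j x| ≤ (j : ℝ) + 1 := fun j x => by
    rw [abs_of_nonneg (hg0 j x)]
    simp only [hg]; split_ifs with h
    exacts [h, by positivity]
  have hgi : ∀ j, Integrable (g j) ν := fun j =>
    integrable_of_abs_le (hgm j).stronglyMeasurable ⟨_, hgb j⟩
  have hgint : ∀ j, ∫ x, g j x ∂ν ≤ 1 / 2 := fun j => by
    rw [integral_eq_lintegral_of_nonneg_ae (ae_of_all _ (hg0 j)) (hgm j).aestronglyMeasurable]
    refine ENNReal.toReal_le_of_le_ofReal (by norm_num) ?_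
    have e : ENNReal.ofReal (1 / 2) = 1 / 2 := by
      rw [ENNReal.ofReal_div_of_pos two_pos]; norm_num
    rw [e]
    refine le_trans (lintegral_mono fun x => ?_) hJ2
    apply ENNReal.ofReal_le_ofReal
    simp only [hg]; split_ifs; exacts [le_rfl, hf0 x]
  have hd := hX.isBoundedMartingaleDiff (fun j _ z => g j z - ∫ x, g j x ∂ν)
    (fun j => ((hgm j).comp measurable_snd).sub measurable_const)
    (fun j => ⟨((j : ℝ) + 1) + ((j : ℝ) + 1), fun _ z => (abs_sub _ _).trans
      (add_le_add (hgb j z) (abs_integral_le_of_abs_le (hgb j)))⟩)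
    (fun j _ => by rw [integral_sub (hgi j) (integrable_const _)]; simp)
  have hmax := hd.measure_exists_half_lt_abs_sum_le (b := fun n : ℕ => (n : ℝ) + 1)
    (fun n => by positivity) (fun a b hab => by simpa using hab)
  have hvar : ∀ j, ∫ ω, (g j (X j ω) - ∫ x, g j x ∂ν) ^ 2 ∂μ ≤ ∫ x, g j x ^ 2 ∂ν := fun j => by
    have e : ∫ ω, (g j (X j ω) - ∫ x, g j x ∂ν) ^ 2 ∂μ =
        ∫ z, (g j z - ∫ x, g j x ∂ν) ^ 2 ∂ν :=
      hX.integral_single j (((hgm j).sub_const _).pow_const 2)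
    rw [e, ← variance_eq_integral (hgm j).aemeasurable]
    exact variance_le_expectation_sq (hgm j).aestronglyMeasurable
  -- Either some truncation is active, which costs `J`, or the centred truncated sum is large, which
  -- costs 48 `J` with 48 = 16 · 3.
  have hsub : {ω | ∃ n : ℕ, (n : ℝ) + 1 < ∑ i ∈ Finset.range (n + 1), f (X i ω)} ⊆
      (⋃ j : ℕ, {ω | (j : ℝ) + 1 < f (X j ω)}) ∪
      {ω | ∃ n : ℕ, ((n : ℝ) + 1) / 2 <
        |∑ j ∈ Finset.range (n + 1), (g j (X j ω) - ∫ x, g j x ∂ν)|} := by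
    rintro ω ⟨n, hn⟩
    by_contra hcon
    simp only [Set.mem_union, Set.mem_iUnion, Set.mem_ofPred_eq, not_or, not_exists, not_lt] at hcon
    obtain ⟨h1, h2⟩ := hcon
    have h3 := (abs_le.1 (h2 n)).2
    have h4 : ∀ j, g j (X j ω) = f (X j ω) := fun j => by simp only [hg]; rw [if_pos (h1 j)]
    simp_rw [h4] at h3
    rw [Finset.sum_sub_distrib] at h3
    have h5 : ∑ j ∈ Finset.range (n + 1), ∫ x, g j x ∂ν ≤ ∑ j ∈ Finset.range (n + 1), (1 / 2 : ℝ) :=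
      Finset.sum_le_sum fun j _ => hgint j
    simp only [Finset.sum_const, Finset.card_range, nsmul_eq_mul] at h5
    push_cast at h5
    linarith
  have hB : μ (⋃ j : ℕ, {ω | (j : ℝ) + 1 < f (X j ω)}) ≤ J := by
    have hms : ∀ j : ℕ, MeasurableSet {x | (j : ℝ) + 1 < f x} := fun j =>
      measurableSet_lt measurable_const hf
    calc _ ≤ ∑' j : ℕ, μ {ω | (j : ℝ) + 1 < f (X j ω)} := measure_iUnion_le _
      _ = ∑' j : ℕ, ∫⁻ x, ENNReal.ofReal (if (j : ℝ) + 1 < f x then 1 else 0) ∂ν := by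
        congr 1; ext j
        have : μ {ω | (j : ℝ) + 1 < f (X j ω)} = ν {x | (j : ℝ) + 1 < f x} := by
          rw [← hX.law j, Measure.map_apply (hX.meas j) (hms j)]; rfl
        rw [this, ← lintegral_indicator_one (hms j)]
        congr 1; ext x
        simp only [Set.indicator, Set.mem_ofPred_eq]
        split_ifs <;> simp
      _ = ∫⁻ x, ∑' j : ℕ, ENNReal.ofReal (if (j : ℝ) + 1 < f x then 1 else 0) ∂ν := by
        rw [lintegral_tsum]
        intro j
        exact (Measurable.ite (hms j) measurable_const measurable_const).ennreal_ofReal.aemeasurable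
      _ ≤ J := by
        refine lintegral_mono fun x => tsum_ofReal_le (fun j => by split_ifs <;> norm_num) fun N => ?_
        simpa using sum_rpow_head_le (r := 1) one_pos le_rfl (hf0 x) N
  have hA : ∑' j : ℕ, ENNReal.ofReal (16 * ((∫ ω, (g j (X j ω) - ∫ x, g j x ∂ν) ^ 2 ∂μ) /
      ((j : ℝ) + 1) ^ 2)) ≤ 48 * J := by
    calc _ ≤ ∑' j : ℕ, ∫⁻ x, ENNReal.ofReal (16 * (g j x ^ 2 / ((j : ℝ) + 1) ^ 2)) ∂ν := by
          refine ENNReal.tsum_le_tsum fun j => ?_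
          rw [← ofReal_integral_eq_lintegral_ofReal]
          · rw [integral_const_mul, integral_div]
            gcongr
            exact hvar j
          · refine ((integrable_of_abs_le ((hgm j).pow_const 2).stronglyMeasurable
              ⟨((j : ℝ) + 1) ^ 2, fun x => ?_⟩).div_const _).const_mul _
            rw [abs_pow]; gcongr; exact hgb j x
          · exact ae_of_all _ fun x => by positivity
      _ = ∫⁻ x, ∑' j : ℕ, ENNReal.ofReal (16 * (g j x ^ 2 / ((j : ℝ) + 1) ^ 2)) ∂ν := by
          rw [lintegral_tsum]
          intro j
          exact ((((hgm j).pow_const 2).div_const _).const_mul _).ennreal_ofReal.aemeasurable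
      _ ≤ ∫⁻ x, 48 * ENNReal.ofReal (f x) ∂ν := by
          refine lintegral_mono fun x => ?_
          have e : 48 * ENNReal.ofReal (f x) = ENNReal.ofReal (48 * f x) := by
            rw [ENNReal.ofReal_mul (by norm_num)]; norm_num
          rw [e]
          refine tsum_ofReal_le (fun j => by positivity) fun N => ?_
          rw [← Finset.mul_sum]
          have := sum_sq_div_below_le (hf0 x) N
          simp only [hg]
          linarith
      _ = 48 * J := lintegral_const_mul _ hf.ennreal_ofReal
  calc _ ≤ J + 48 * J := (measure_mono hsub).trans ((measure_union_le _ _).trans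
        (add_le_add hB (hmax.trans hA)))
    _ = 49 * J := by ring

end IsIIDWithLaw

/-! ### Truncated kernels. -/

section Trunc

variable {E : Type*} {h : E → E → ℝ}

/-- The kernel `h` truncated at level `c`. -/
noncomputable def trunc (h : E → E → ℝ) (c : ℝ) (x y : E) : ℝ := if |h x y| ≤ c then h x y else 0

lemma abs_trunc_le {c : ℝ} (hc : 0 ≤ c) (x y : E) : |trunc h c x y| ≤ c := by
  unfold trunc; split_ifs with hle
  · exact hle
  · simpa using hc

lemma abs_trunc_le_abs (c : ℝ) (x y : E) : |trunc h c x y| ≤ |h x y| := by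
  unfold trunc; split_ifs <;> simp

lemma trunc_symm (hsymm : ∀ x y, h x y = h y x) (c : ℝ) (x y : E) :
    trunc h c x y = trunc h c y x := by unfold trunc; rw [hsymm x y]

lemma sub_trunc (c : ℝ) (x y : E) : h x y - trunc h c x y = if c < |h x y| then h x y else 0 := by
  unfold trunc
  rcases le_or_gt (|h x y|) c with hle | hlt
  · rw [if_pos hle, if_neg hle.not_gt, sub_self]
  · rw [if_neg hlt.not_ge, if_pos hlt, sub_zero]

variable [MeasurableSpace E]

lemma measurable_trunc (hh : Measurable (Function.uncurry h)) (c : ℝ) :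
    Measurable (Function.uncurry (trunc h c)) :=
  Measurable.ite (measurableSet_le hh.abs measurable_const) hh measurable_const

variable {ν : Measure E} [IsProbabilityMeasure ν]

lemma proj_trunc_eq (hh : Measurable (Function.uncurry h)) {c : ℝ} (hc : 0 ≤ c) {x : E}
    (hint : Integrable (h x) ν) (h0 : ∫ y, h x y ∂ν = 0) :
    proj ν (trunc h c) x = -proj ν (fun x y => h x y - trunc h c x y) x := by
  have h1 : Integrable (trunc h c x) ν :=
    integrable_of_abs_le (measurable_section (measurable_trunc hh c) x).stronglyMeasurable
      ⟨c, abs_trunc_le hc x⟩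
  unfold proj
  rw [integral_sub hint h1, h0]
  ring

/-- Truncating a degenerate kernel costs at most the tail of the kernel. -/
lemma lintegral_proj_trunc_le (hh : Measurable (Function.uncurry h)) {c : ℝ} (hc : 0 ≤ c)
    (hint : ∀ x, Integrable (h x) ν ∧ ∫ y, h x y ∂ν = 0) :
    ∫⁻ x, ‖proj ν (trunc h c) x‖ₑ ∂ν ≤
      ∫⁻ z, ENNReal.ofReal (if c < |h z.1 z.2| then |h z.1 z.2| else 0) ∂(ν.prod ν) := by
  have hm : Measurable (Function.uncurry fun x y => h x y - trunc h c x y) :=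
    hh.sub (measurable_trunc hh c)
  have := lintegral_proj_rpow_le (ν := ν) le_rfl hm
  simp only [ENNReal.rpow_one] at this
  calc _ = ∫⁻ x, ‖proj ν (fun x y => h x y - trunc h c x y) x‖ₑ ∂ν := by
        congr 1; ext x
        rw [proj_trunc_eq hh hc (hint x).1 (hint x).2, enorm_neg]
    _ ≤ _ := this
    _ = _ := by
        congr 1; ext z
        rw [sub_trunc, Real.enorm_eq_ofReal_abs]
        congr 1
        split_ifs <;> simp

end Trunc

/-- Converts one Hájek–Rényi term into a truncated second moment of `h`: 1024 is 16 times 4² · 4,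
the constant of `lintegral_degPart_rpow_le` at exponent 2. -/
lemma ofReal_integral_degPart_trunc_sq_le {E : Type*} [MeasurableSpace E] {h : E → E → ℝ}
    {ν : Measure E} [IsProbabilityMeasure ν] (hh : Measurable (Function.uncurry h)) (p : ℝ) (j : ℕ) :
    ENNReal.ofReal (16 * ((j * ∫ z, degPart ν (trunc h (level p j)) z.1 z.2 ^ 2 ∂(ν.prod ν)) /
      level p j ^ 2)) ≤
      ∫⁻ z, ENNReal.ofReal (1024 * (if |h z.1 z.2| ≤ level p j then
        (j : ℝ) * (h z.1 z.2 ^ 2 / level p j ^ 2) else 0)) ∂(ν.prod ν) := by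
  have hk := measurable_trunc hh (level p j)
  have hkb := abs_trunc_le (h := h) (level_pos p j).le
  have hφ := measurable_degPart (ν := ν) hk
  have hφb := abs_degPart_le (ν := ν) hkb
  have hl := level_pos p j
  have hφm : Measurable fun z : E × E => degPart ν (trunc h (level p j)) z.1 z.2 := hφ
  have e1 : ∀ a : ℝ, 16 * (j * a / level p j ^ 2) = 16 * j / level p j ^ 2 * a := fun a => by
    ring
  rw [e1, ENNReal.ofReal_mul (by positivity), ofReal_integral_eq_lintegral_ofReal
    (integrable_of_abs_le (hφm.pow_const 2).stronglyMeasurable ⟨(4 * level p j) ^ 2, fun z => by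
      rw [abs_pow]; gcongr; exact hφb _ _⟩) (ae_of_all _ fun z => sq_nonneg _)]
  have e2 : ∀ a : ℝ, ENNReal.ofReal (a ^ 2) = ‖a‖ₑ ^ (2 : ℝ) := fun a => by
    rw [← ofReal_abs_rpow zero_le_two, Real.rpow_two, sq_abs]
  simp_rw [e2]
  refine (mul_le_mul_right (lintegral_degPart_rpow_le one_le_two (hk)) _).trans ?_
  have e3 : (4 : ℝ≥0∞) ^ (2 : ℝ) * 4 = ENNReal.ofReal 64 := by
    rw [ENNReal.rpow_two]; norm_num
  rw [e3, ← mul_assoc, ← ENNReal.ofReal_mul (by positivity)]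
  have hkm : Measurable fun z : E × E => trunc h (level p j) z.1 z.2 := hk
  rw [← lintegral_const_mul _ (by fun_prop)]
  refine lintegral_mono fun z => ?_
  beta_reduce
  rw [← e2, ← ENNReal.ofReal_mul (by positivity)]
  apply ENNReal.ofReal_le_ofReal
  apply le_of_eq
  unfold trunc
  split_ifs
  · field_simp; linarith
  · simp

/-! ### The degenerate part and the large values of the kernel. -/

namespace IsIIDWithLaw

variable {Ω E : Type*} [mΩ : MeasurableSpace Ω] [MeasurableSpace E]
    {X : ℕ → Ω → E} {μ : Measure Ω} {ν : Measure E} {h : E → E → ℝ} {p : ℝ}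

lemma isBoundedMartingaleDiff_pair (hX : IsIIDWithLaw X μ ν) [IsProbabilityMeasure μ]
    [IsProbabilityMeasure ν] {φ : ℕ → E → E → ℝ} (hφ : ∀ j, Measurable (Function.uncurry (φ j)))
    (hb : ∀ j, ∃ C, ∀ x y, |φ j x y| ≤ C) (h0 : ∀ j x, ∫ y, φ j x y ∂ν = 0) :
    IsBoundedMartingaleDiff (filtration hX.meas) μ
      (fun j ω => ∑ i ∈ Finset.range j, φ j (X i ω) (X j ω)) := by
  have e : (fun j ω => ∑ i ∈ Finset.range j, φ j (X i ω) (X j ω)) =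
      fun j ω => ∑ i : Finset.range j, φ j (history X j ω i) (X j ω) := by
    funext j ω
    exact (Finset.sum_coe_sort (Finset.range j) fun i => φ j (X i ω) (X j ω)).symm
  rw [e]
  refine hX.isBoundedMartingaleDiff (fun j y z => ∑ i : Finset.range j, φ j (y i) z)
    (fun j => ?_) (fun j => ?_) (fun j y => ?_)
  · have hpair : ∀ i : Finset.range j,
        Measurable fun q : (Finset.range j → E) × E => (q.1 i, q.2) := fun i =>
      ((measurable_pi_apply i).comp measurable_fst).prodMk measurable_snd
    exact Finset.measurable_fun_sum _ fun i _ => (hφ j).comp (hpair i)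
  · obtain ⟨C, hC⟩ := hb j
    exact ⟨∑ i : Finset.range j, C, fun y z =>
      (Finset.abs_sum_le_sum_abs _ _).trans (Finset.sum_le_sum fun i _ => hC _ _)⟩
  · obtain ⟨C, hC⟩ := hb j
    rw [integral_finsetSum]
    · simp [h0]
    · exact fun i _ => integrable_of_abs_le (measurable_section (hφ j) _).stronglyMeasurable
        ⟨C, hC _⟩

lemma measure_exists_level_lt_degPart_le (hX : IsIIDWithLaw X μ ν) [IsProbabilityMeasure μ]
    [IsProbabilityMeasure ν] (hp0 : 0 < p) (hp2 : p < 2) (hh : Measurable (Function.uncurry h))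
    (hsymm : ∀ x y, h x y = h y x) :
    μ {ω | ∃ n, level p n / 2 < |∑ j ∈ Finset.range (n + 1), ∑ i ∈ Finset.range j,
      degPart ν (trunc h (level p j)) (X i ω) (X j ω)|} ≤
      ENNReal.ofReal (1024 * ((4 / p) / (4 / p - 2))) *
        ∫⁻ z, ‖h z.1 z.2‖ₑ ^ p ∂(ν.prod ν) := by
  have hk : ∀ j, Measurable (Function.uncurry (trunc h (level p j))) :=
    fun j => measurable_trunc hh (level p j)
  have hkb : ∀ j x y, |trunc h (level p j) x y| ≤ level p j :=
    fun j => abs_trunc_le (level_pos p j).le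
  have hφ : ∀ j, Measurable (Function.uncurry (degPart ν (trunc h (level p j)))) :=
    fun j => measurable_degPart (hk j)
  have hφb : ∀ j x y, |degPart ν (trunc h (level p j)) x y| ≤ 4 * level p j :=
    fun j => abs_degPart_le (hkb j)
  have hφ0 : ∀ j x, ∫ y, degPart ν (trunc h (level p j)) x y ∂ν = 0 :=
    fun j => integral_degPart (hk j) (hkb j)
  have hmax := (hX.isBoundedMartingaleDiff_pair hφ (fun j => ⟨_, hφb j⟩)
    hφ0).measure_exists_half_lt_abs_sum_le (level_pos p) (level_mono hp0)
  refine hmax.trans ?_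
  have hterm : ∀ j : ℕ, ENNReal.ofReal (16 * ((∫ ω, (∑ i ∈ Finset.range j,
      degPart ν (trunc h (level p j)) (X i ω) (X j ω)) ^ 2 ∂μ) / level p j ^ 2)) ≤
      ∫⁻ z, ENNReal.ofReal (1024 * (if |h z.1 z.2| ≤ level p j then
        (j : ℝ) * (h z.1 z.2 ^ 2 / level p j ^ 2) else 0)) ∂(ν.prod ν) := fun j => by
    rw [hX.integral_sq_sum_pair (hφ j) ⟨_, hφb j⟩ (degPart_symm (trunc_symm hsymm _)) (hφ0 j)]
    exact ofReal_integral_degPart_trunc_sq_le hh p j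
  refine (ENNReal.tsum_le_tsum hterm).trans ?_
  have hh' : Measurable fun z : E × E => h z.1 z.2 := hh
  rw [← lintegral_tsum, ← lintegral_const_mul _ (by fun_prop)]
  · refine lintegral_mono fun z => ?_
    beta_reduce
    rw [← ofReal_abs_rpow hp0.le, ← ENNReal.ofReal_mul (by
      have : 2 < 4 / p := by rw [lt_div_iff₀ hp0]; linarith
      have : 0 < 4 / p - 2 := by linarith
      positivity)]
    refine tsum_ofReal_le (fun j => ?_) fun N => ?_
    · have := level_pos p j
      split_ifs <;> positivity
    · rw [← Finset.mul_sum, mul_assoc]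
      gcongr
      exact sum_sq_div_level_below_level_le hp0 hp2 _ N
  · exact fun j => ((Measurable.ite (measurableSet_le hh'.abs measurable_const)
      (by fun_prop) measurable_const).const_mul _).ennreal_ofReal.aemeasurable

lemma measure_exists_level_lt_abs_le (hX : IsIIDWithLaw X μ ν) [IsProbabilityMeasure μ]
    [IsProbabilityMeasure ν] (hp0 : 0 < p) (hh : Measurable (Function.uncurry h)) :
    μ {ω | ∃ j : ℕ, ∃ i ∈ Finset.range j, level p j < |h (X i ω) (X j ω)|} ≤
      ∫⁻ z, ‖h z.1 z.2‖ₑ ^ p ∂(ν.prod ν) := by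
  have hh' : Measurable fun z : E × E => h z.1 z.2 := hh
  have hms : ∀ j, MeasurableSet {z : E × E | level p j < |h z.1 z.2|} := fun j =>
    measurableSet_lt measurable_const hh'.abs
  have hset : {ω | ∃ j : ℕ, ∃ i ∈ Finset.range j, level p j < |h (X i ω) (X j ω)|} =
      ⋃ j : ℕ, ⋃ i ∈ Finset.range j, {ω | level p j < |h (X i ω) (X j ω)|} := by
    ext ω; simp
  rw [hset]
  have hpair : ∀ j, ∀ i ∈ Finset.range j, μ {ω | level p j < |h (X i ω) (X j ω)|} =
      ν.prod ν {z | level p j < |h z.1 z.2|} := fun j i hi => by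
    rw [← hX.map_pair (Finset.mem_range.1 hi).ne,
      Measure.map_apply ((hX.meas i).prodMk (hX.meas j)) (hms j)]
    rfl
  calc _ ≤ ∑' j : ℕ, ∑ i ∈ Finset.range j, μ {ω | level p j < |h (X i ω) (X j ω)|} :=
        (measure_iUnion_le _).trans (ENNReal.tsum_le_tsum fun j => measure_biUnion_finset_le _ _)
    _ = ∑' j : ℕ, ∫⁻ z, ENNReal.ofReal (if level p j < |h z.1 z.2| then (j : ℝ) else 0)
          ∂(ν.prod ν) := by
        congr 1; ext j
        rw [Finset.sum_congr rfl (hpair j), Finset.sum_const, Finset.card_range, nsmul_eq_mul,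
          ← lintegral_indicator_const (hms j)]
        congr 1; ext z
        simp only [Set.indicator, Set.mem_ofPred_eq]
        split_ifs <;> simp
    _ = ∫⁻ z, ∑' j : ℕ, ENNReal.ofReal (if level p j < |h z.1 z.2| then (j : ℝ) else 0)
          ∂(ν.prod ν) := by
        rw [lintegral_tsum]
        exact fun j =>
          (Measurable.ite (hms j) measurable_const measurable_const).ennreal_ofReal.aemeasurable
    _ ≤ _ := by
        refine lintegral_mono fun z => ?_
        beta_reduce
        rw [← ofReal_abs_rpow hp0.le]
        exact tsum_ofReal_le (fun j => by split_ifs <;> positivity)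
          (sum_index_above_level_le hp0 _)

end IsIIDWithLaw

/-! ### The linear part created by truncation. -/

section Correction

variable {E : Type*} [MeasurableSpace E]

/-- The non-degenerate part of a symmetric kernel in its Hoeffding decomposition. -/
noncomputable def linPart (ν : Measure E) (k : E → E → ℝ) (x y : E) : ℝ :=
  proj ν k x + proj ν k y - ∫ z, proj ν k z ∂ν

lemma degPart_add_linPart (ν : Measure E) (k : E → E → ℝ) (x y : E) :
    degPart ν k x y + linPart ν k x y = k x y := by
  unfold degPart linPart; ring

end Correction

namespace IsIIDWithLaw

variable {Ω E : Type*} [mΩ : MeasurableSpace Ω] [MeasurableSpace E]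
    {X : ℕ → Ω → E} {μ : Measure Ω} {ν : Measure E} {h k : E → E → ℝ} {p : ℝ}

lemma measurable_linPart [IsProbabilityMeasure ν] (hX : IsIIDWithLaw X μ ν)
    (hk : Measurable (Function.uncurry k)) (i j : ℕ) :
    Measurable fun ω => linPart ν k (X i ω) (X j ω) := by
  have hp := measurable_proj (ν := ν) hk
  exact ((hp.comp (hX.meas i)).add (hp.comp (hX.meas j))).sub_const _

lemma lintegral_linPart_le (hX : IsIIDWithLaw X μ ν) [IsProbabilityMeasure μ]
    [IsProbabilityMeasure ν] (hk : Measurable (Function.uncurry k)) (i j : ℕ) :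
    ∫⁻ ω, ‖linPart ν k (X i ω) (X j ω)‖ₑ ∂μ ≤ 3 * ∫⁻ x, ‖proj ν k x‖ₑ ∂ν := by
  have hp := measurable_proj (ν := ν) hk
  have hs := fun i => hX.lintegral_single i hp.enorm
  have hm : ∀ i, Measurable fun ω => ‖proj ν k (X i ω)‖ₑ :=
    fun i => (hp.comp (hX.meas i)).enorm
  calc _ ≤ ∫⁻ ω, (‖proj ν k (X i ω)‖ₑ + ‖proj ν k (X j ω)‖ₑ + ‖∫ z, proj ν k z ∂ν‖ₑ) ∂μ := by
        refine lintegral_mono fun ω => ?_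
        unfold linPart
        refine enorm_sub_le.trans ?_
        gcongr
        exact enorm_add_le _ _
    _ ≤ ∫⁻ x, ‖proj ν k x‖ₑ ∂ν + ∫⁻ x, ‖proj ν k x‖ₑ ∂ν + ∫⁻ x, ‖proj ν k x‖ₑ ∂ν := by
        rw [lintegral_add_right _ measurable_const, lintegral_add_left (hm i), hs, hs]
        gcongr
        simpa using enorm_integral_le_lintegral_enorm (μ := ν) (proj ν k)
    _ = _ := by ring

/-- No cancellation between pairs is used: the sums of absolute values, weighted by inverse levels,
already have a finite first moment when E|h|^p is finite. -/
lemma measure_exists_level_lt_linPart_le (hX : IsIIDWithLaw X μ ν) [IsProbabilityMeasure μ]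
    [IsProbabilityMeasure ν] (hp1 : 1 < p) (hp2 : p < 2) (hh : Measurable (Function.uncurry h))
    (hint : ∀ x, Integrable (h x) ν ∧ ∫ y, h x y ∂ν = 0) :
    μ {ω | ∃ n, level p n / 2 < |∑ j ∈ Finset.range (n + 1), ∑ i ∈ Finset.range j,
      linPart ν (trunc h (level p j)) (X i ω) (X j ω)|} ≤
      ENNReal.ofReal (6 * (2 - 2 / p)⁻¹) * ∫⁻ z, ‖h z.1 z.2‖ₑ ^ p ∂(ν.prod ν) := by
  have hp0 : 0 < p := by linarith
  have hh' : Measurable fun z : E × E => h z.1 z.2 := hh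
  -- Since levels increase, dividing each term by its own level dominates division by `level p n`,
  -- uniformly in n.
  set W : Ω → ℝ≥0∞ := fun ω => ∑' j : ℕ, ∑ i ∈ Finset.range j,
    ENNReal.ofReal (level p j)⁻¹ * ‖linPart ν (trunc h (level p j)) (X i ω) (X j ω)‖ₑ with hW
  have hkm : ∀ j, Measurable (Function.uncurry (trunc h (level p j))) :=
    fun j => measurable_trunc hh (level p j)
  have hcm : ∀ j i, Measurable fun ω => ENNReal.ofReal (level p j)⁻¹ *
      ‖linPart ν (trunc h (level p j)) (X i ω) (X j ω)‖ₑ := fun j i =>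
    (hX.measurable_linPart (hkm j) i j).enorm.const_mul _
  have hWm : Measurable W :=
    Measurable.tsum fun j => Finset.measurable_fun_sum _ fun i _ => hcm j i
  have hsub : {ω | ∃ n, level p n / 2 < |∑ j ∈ Finset.range (n + 1), ∑ i ∈ Finset.range j,
      linPart ν (trunc h (level p j)) (X i ω) (X j ω)|} ⊆ {ω | 2⁻¹ ≤ W ω} := by
    rintro ω ⟨n, hn⟩
    have hln := level_pos p n
    have h1 : (2 : ℝ)⁻¹ ≤ ∑ j ∈ Finset.range (n + 1), ∑ i ∈ Finset.range j,
        (level p j)⁻¹ * |linPart ν (trunc h (level p j)) (X i ω) (X j ω)| := by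
      calc (2 : ℝ)⁻¹ = (level p n)⁻¹ * (level p n / 2) := by field_simp
        _ ≤ (level p n)⁻¹ * ∑ j ∈ Finset.range (n + 1), ∑ i ∈ Finset.range j,
              |linPart ν (trunc h (level p j)) (X i ω) (X j ω)| := by
            gcongr
            exact hn.le.trans ((Finset.abs_sum_le_sum_abs _ _).trans
              (Finset.sum_le_sum fun j _ => Finset.abs_sum_le_sum_abs _ _))
        _ ≤ _ := by
            rw [Finset.mul_sum]
            refine Finset.sum_le_sum fun j hj => ?_
            rw [Finset.mul_sum]
            refine Finset.sum_le_sum fun i _ => ?_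
            have hlj := level_pos p j
            gcongr
            exact level_mono hp0 (Nat.lt_succ_iff.1 (Finset.mem_range.1 hj))
    have h2 := ENNReal.ofReal_le_ofReal h1
    have h3 : ∀ j i, 0 ≤ (level p j)⁻¹ * |linPart ν (trunc h (level p j)) (X i ω) (X j ω)| :=
      fun j i => mul_nonneg (inv_nonneg.2 (level_pos p j).le) (abs_nonneg _)
    rw [ENNReal.ofReal_sum_of_nonneg fun j _ => Finset.sum_nonneg fun i _ => h3 j i,
      ENNReal.ofReal_inv_of_pos two_pos, ENNReal.ofReal_ofNat] at h2
    refine h2.trans (le_trans (Finset.sum_le_sum fun j _ => ?_) (ENNReal.sum_le_tsum _))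
    rw [ENNReal.ofReal_sum_of_nonneg fun i _ => h3 j i]
    refine Finset.sum_le_sum fun i _ => ?_
    rw [ENNReal.ofReal_mul (inv_nonneg.2 (level_pos p j).le), Real.enorm_eq_ofReal_abs]
  have hms : ∀ j, Measurable fun z : E × E =>
      if level p j < |h z.1 z.2| then |h z.1 z.2| else 0 := fun j =>
    Measurable.ite (measurableSet_lt measurable_const hh'.abs) hh'.abs measurable_const
  have hms' : ∀ j : ℕ, Measurable fun z : E × E => ENNReal.ofReal (3 * if level p j < |h z.1 z.2|
      then (j : ℝ) * (|h z.1 z.2| / level p j) else 0) := fun j =>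
    ((Measurable.ite (measurableSet_lt measurable_const hh'.abs)
      ((hh'.abs.div_const _).const_mul _) measurable_const).const_mul _).ennreal_ofReal
  have hWint : ∫⁻ ω, W ω ∂μ ≤
      ENNReal.ofReal (3 * (2 - 2 / p)⁻¹) * ∫⁻ z, ‖h z.1 z.2‖ₑ ^ p ∂(ν.prod ν) := by
    calc ∫⁻ ω, W ω ∂μ = ∑' j : ℕ, ∑ i ∈ Finset.range j, ENNReal.ofReal (level p j)⁻¹ *
          ∫⁻ ω, ‖linPart ν (trunc h (level p j)) (X i ω) (X j ω)‖ₑ ∂μ := by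
          rw [hW, lintegral_tsum fun j =>
            (Finset.measurable_fun_sum _ fun i _ => hcm j i).aemeasurable]
          congr 1; ext j
          rw [lintegral_finsetSum _ fun i _ => hcm j i]
          refine Finset.sum_congr rfl fun i _ => ?_
          rw [lintegral_const_mul _ (hX.measurable_linPart (hkm j) i j).enorm]
      _ ≤ ∑' j : ℕ, ∑ i ∈ Finset.range j, ENNReal.ofReal (level p j)⁻¹ * (3 *
          ∫⁻ z, ENNReal.ofReal (if level p j < |h z.1 z.2| then |h z.1 z.2| else 0)
            ∂(ν.prod ν)) := by
          refine ENNReal.tsum_le_tsum fun j => Finset.sum_le_sum fun i _ => ?_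
          gcongr
          refine (hX.lintegral_linPart_le (hkm j) i j).trans ?_
          gcongr
          exact lintegral_proj_trunc_le hh (level_pos p j).le hint
      _ = ∑' j : ℕ, ∫⁻ z, ENNReal.ofReal (3 * if level p j < |h z.1 z.2| then
            (j : ℝ) * (|h z.1 z.2| / level p j) else 0) ∂(ν.prod ν) := by
          congr 1; ext j
          have hl := level_pos p j
          rw [Finset.sum_const, Finset.card_range, nsmul_eq_mul,
            ← lintegral_const_mul _ (hms j).ennreal_ofReal,
            ← lintegral_const_mul _ ((hms j).ennreal_ofReal.const_mul _),
            ← lintegral_const_mul _ (((hms j).ennreal_ofReal.const_mul _).const_mul _)]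
          congr 1; ext z
          rw [← ENNReal.ofReal_natCast j, ← ENNReal.ofReal_ofNat 3,
            ← ENNReal.ofReal_mul (by norm_num), ← ENNReal.ofReal_mul (by positivity),
            ← ENNReal.ofReal_mul (by positivity)]
          congr 1
          split_ifs
          · field_simp
          · simp
      _ = ∫⁻ z, ∑' j : ℕ, ENNReal.ofReal (3 * if level p j < |h z.1 z.2| then
            (j : ℝ) * (|h z.1 z.2| / level p j) else 0) ∂(ν.prod ν) :=
          (lintegral_tsum fun j => (hms' j).aemeasurable).symm
      _ ≤ _ := by
          rw [← lintegral_const_mul _ (by fun_prop)]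
          refine lintegral_mono fun z => ?_
          have hr : 0 < 2 - 2 / p := by rw [sub_pos, div_lt_iff₀ hp0]; linarith
          beta_reduce
          rw [← ofReal_abs_rpow hp0.le, ← ENNReal.ofReal_mul (by positivity)]
          refine tsum_ofReal_le (fun j => ?_) fun N => ?_
          · have := level_pos p j
            split_ifs <;> positivity
          · rw [← Finset.mul_sum, mul_assoc]
            gcongr
            exact sum_div_level_above_level_le hp1 hp2 _ N
  have hmarkov := mul_meas_ge_le_lintegral (μ := μ) hWm 2⁻¹
  calc _ ≤ μ {ω | 2⁻¹ ≤ W ω} := measure_mono hsub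
    _ = 2 * (2⁻¹ * μ {ω | 2⁻¹ ≤ W ω}) := by
        rw [← mul_assoc, ENNReal.mul_inv_cancel two_ne_zero ENNReal.ofNat_ne_top, one_mul]
    _ ≤ 2 * (ENNReal.ofReal (3 * (2 - 2 / p)⁻¹) * ∫⁻ z, ‖h z.1 z.2‖ₑ ^ p ∂(ν.prod ν)) := by
        exact mul_le_mul_right (hmarkov.trans hWint) 2
    _ = _ := by
        rw [← mul_assoc, ← ENNReal.ofReal_ofNat 2, ← ENNReal.ofReal_mul two_pos.le]
        congr 2; ring

/-- First moments do not suffice at p = 1. The linear part is dominated by sums of one-variable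
functions, for which `measure_exists_lt_sum_le` is available; 392 = 8 · 49. -/
lemma measure_exists_level_one_lt_linPart_le (hX : IsIIDWithLaw X μ ν) [IsProbabilityMeasure μ]
    [IsProbabilityMeasure ν] (hh : Measurable (Function.uncurry h))
    (hint : ∀ x, Integrable (h x) ν) :
    μ {ω | ∃ n, level 1 n / 2 < |∑ j ∈ Finset.range (n + 1), ∑ i ∈ Finset.range j,
      linPart ν (trunc h (level 1 j)) (X i ω) (X j ω)|} ≤
      392 * ∫⁻ z, ‖h z.1 z.2‖ₑ ∂(ν.prod ν) := by
  set I := ∫⁻ z, ‖h z.1 z.2‖ₑ ∂(ν.prod ν) with hI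
  have hh' : Measurable fun z : E × E => h z.1 z.2 := hh
  -- A large `I` is trivial; a small one bounds the constant term of `linPart` by 1/4.
  by_cases hI4 : 1 / 4 < I
  · calc _ ≤ (1 : ℝ≥0∞) := prob_le_one
      _ = 4 * (1 / 4) := by rw [ENNReal.mul_div_cancel] <;> norm_num
      _ ≤ 392 * I := by gcongr; norm_num
  rw [not_lt] at hI4
  set g : E → ℝ := proj ν (fun x y => |h x y|) with hg
  have hgm : Measurable g := measurable_proj hh'.abs
  have hg0 : ∀ x, 0 ≤ g x := fun x => integral_nonneg fun y => abs_nonneg _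
  have hgI : ∫⁻ x, ENNReal.ofReal (g x) ∂ν = I := by
    rw [hI, lintegral_prod _ hh'.enorm.aemeasurable]
    congr 1; ext x
    exact ofReal_integral_norm_eq_lintegral_enorm (hint x)
  have hproj : ∀ j x, |proj ν (trunc h (level 1 j)) x| ≤ g x := fun j x => by
    refine abs_integral_le_integral_abs.trans (integral_mono ?_ (hint x).abs fun y => ?_)
    · exact (integrable_of_abs_le
        (measurable_section (measurable_trunc hh _) x).stronglyMeasurable
        ⟨_, abs_trunc_le (level_pos 1 j).le x⟩).abs
    · exact abs_trunc_le_abs _ _ _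
  have hmean : ∀ j, |∫ x, proj ν (trunc h (level 1 j)) x ∂ν| ≤ 1 / 4 := fun j => by
    rw [← ENNReal.ofReal_le_ofReal_iff (by norm_num), ← Real.enorm_eq_ofReal_abs]
    refine (enorm_integral_le_lintegral_enorm _).trans ?_
    have e : ENNReal.ofReal (1 / 4) = 1 / 4 := by
      rw [ENNReal.ofReal_div_of_pos four_pos]; norm_num
    rw [e]
    refine le_trans (lintegral_mono fun x => ?_) (hgI.trans_le hI4)
    beta_reduce
    rw [Real.enorm_eq_ofReal_abs]
    exact ENNReal.ofReal_le_ofReal (hproj j x)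
  have hlin : ∀ j x y, |linPart ν (trunc h (level 1 j)) x y| ≤ g x + g y + 1 / 4 := fun j x y => by
    unfold linPart
    exact (abs_sub _ _).trans (add_le_add ((abs_add_le _ _).trans
      (add_le_add (hproj j x) (hproj j y))) (hmean j))
  -- The factor 8 is chosen so that S ≤ (n+1)/8 gives 2(n+1)S + (n+1)²/4 ≤ (n+1)²/2, half of `level
  -- 1 n`.
  have hmax := hX.measure_exists_lt_sum_le (f := fun x => 8 * g x) (hgm.const_mul 8)
    (fun x => mul_nonneg (by norm_num) (hg0 x))
  have hsub : {ω | ∃ n, level 1 n / 2 < |∑ j ∈ Finset.range (n + 1), ∑ i ∈ Finset.range j,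
      linPart ν (trunc h (level 1 j)) (X i ω) (X j ω)|} ⊆
      {ω | ∃ n : ℕ, (n : ℝ) + 1 < ∑ i ∈ Finset.range (n + 1), 8 * g (X i ω)} := by
    rintro ω ⟨n, hn⟩
    refine ⟨n, ?_⟩
    by_contra hcon
    rw [not_lt, ← Finset.mul_sum] at hcon
    set S := ∑ i ∈ Finset.range (n + 1), g (X i ω) with hS
    have h1 : |∑ j ∈ Finset.range (n + 1), ∑ i ∈ Finset.range j,
        linPart ν (trunc h (level 1 j)) (X i ω) (X j ω)| ≤
        ∑ j ∈ Finset.range (n + 1), ∑ i ∈ Finset.range (n + 1), (g (X i ω) + g (X j ω) + 1 / 4) := by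
      refine (Finset.abs_sum_le_sum_abs _ _).trans (Finset.sum_le_sum fun j hj => ?_)
      refine (Finset.abs_sum_le_sum_abs _ _).trans ?_
      refine (Finset.sum_le_sum fun i _ => hlin j _ _).trans ?_
      refine Finset.sum_le_sum_of_subset_of_nonneg
        (Finset.range_subset_range.2 (Finset.mem_range.1 hj).le) fun i _ _ => ?_
      have := hg0 (X i ω)
      have := hg0 (X j ω)
      positivity
    have h2 : ∑ j ∈ Finset.range (n + 1), ∑ i ∈ Finset.range (n + 1),
        (g (X i ω) + g (X j ω) + 1 / 4) = 2 * ((n : ℝ) + 1) * S + ((n : ℝ) + 1) ^ 2 / 4 := by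
      simp only [Finset.sum_add_distrib, Finset.sum_const, Finset.card_range, nsmul_eq_mul,
        ← Finset.mul_sum, ← hS]
      push_cast
      ring
    rw [level_one] at hn
    have hn0 : (0 : ℝ) < (n : ℝ) + 1 := by positivity
    nlinarith
  refine (measure_mono hsub).trans (hmax.trans_eq ?_)
  simp_rw [ENNReal.ofReal_mul (show (0 : ℝ) ≤ 8 by norm_num)]
  rw [lintegral_const_mul _ hgm.ennreal_ofReal, hgI, ENNReal.ofReal_ofNat, ← mul_assoc]
  norm_num

end IsIIDWithLaw

-- Assembly of the weak type inequality.

universe u v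

/-- The sum of `h (X i) (X j)` over `i < j < n`. -/
def pairSum {Ω E : Type*} (h : E → E → ℝ) (X : ℕ → Ω → E) (n : ℕ) (ω : Ω) : ℝ :=
  ∑ j ∈ Finset.range n, ∑ i ∈ Finset.range j, h (X i ω) (X j ω)

lemma pairSum_sub {Ω E : Type*} (h k : E → E → ℝ) (X : ℕ → Ω → E) (n : ℕ) (ω : Ω) :
    pairSum (fun x y => h x y - k x y) X n ω = pairSum h X n ω - pairSum k X n ω := by
  simp only [pairSum, Finset.sum_sub_distrib]

/-- `h` is a measurable symmetric kernel, degenerate with respect to `ν`. -/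
structure IsDegenerateKernel {E : Type*} [MeasurableSpace E] (h : E → E → ℝ) (ν : Measure E) :
    Prop where
  meas : Measurable (Function.uncurry h)
  symm : ∀ x y, h x y = h y x
  int : ∀ x, Integrable (h x) ν ∧ ∫ y, h x y ∂ν = 0

lemma IsDegenerateKernel.sub {E : Type*} [MeasurableSpace E] {h k : E → E → ℝ} {ν : Measure E}
    (hh : IsDegenerateKernel h ν)
    (hk : IsDegenerateKernel k ν) : IsDegenerateKernel (fun x y => h x y - k x y) ν where
  meas := hh.meas.sub hk.meas
  symm x y := by rw [hh.symm, hk.symm]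
  int x := ⟨(hh.int x).1.sub (hk.int x).1, by
    rw [integral_sub (hh.int x).1 (hk.int x).1, (hh.int x).2, (hk.int x).2, sub_zero]⟩

lemma ae_exists_notMem_of_tendsto {Ω : Type*} [MeasurableSpace Ω] {μ : Measure Ω} {S : ℕ → Set Ω} {a : ℕ → ℝ≥0∞} (hS : ∀ T, μ (S T) ≤ a T)
    (ha : Tendsto a atTop (𝓝 0)) : ∀ᵐ ω ∂μ, ∃ T, ω ∉ S T := by
  rw [ae_iff]
  refine le_antisymm (ge_of_tendsto' ha fun T => ?_) zero_le
  refine (measure_mono fun ω hω => ?_).trans (hS T)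
  simp only [Set.mem_ofPred_eq, not_exists, not_not] at hω
  exact hω T

namespace IsIIDWithLaw

variable {Ω E : Type*} [mΩ : MeasurableSpace Ω] [MeasurableSpace E]
    {X : ℕ → Ω → E} {μ : Measure Ω} {ν : Measure E} {h : E → E → ℝ} {p : ℝ}

/-- Off the three exceptional events every kernel value is untruncated and each Hoeffding part is at
most half the level. The linear bound enters as a hypothesis because its proof differs for p = 1 and
p > 1. -/
lemma measure_exists_level_lt_le (hX : IsIIDWithLaw X μ ν) [IsProbabilityMeasure μ]
    [IsProbabilityMeasure ν] (hp0 : 0 < p) (hp2 : p < 2) (hh : IsDegenerateKernel h ν) {c : ℝ}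
    (hc : 0 ≤ c)
    (hlin : μ {ω | ∃ n, level p n / 2 < |∑ j ∈ Finset.range (n + 1), ∑ i ∈ Finset.range j,
      linPart ν (trunc h (level p j)) (X i ω) (X j ω)|} ≤
      ENNReal.ofReal c * ∫⁻ z, ‖h z.1 z.2‖ₑ ^ p ∂(ν.prod ν)) :
    μ {ω | ∃ n, level p n < |pairSum h X (n + 1) ω|} ≤
      ENNReal.ofReal (1024 * ((4 / p) / (4 / p - 2)) + 2 + c) *
        ∫⁻ z, ‖h z.1 z.2‖ₑ ^ p ∂(ν.prod ν) := by
  have hA := hX.measure_exists_level_lt_degPart_le hp0 hp2 hh.meas hh.symm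
  have hB := hX.measure_exists_level_lt_abs_le hp0 hh.meas
  set I := ∫⁻ z, ‖h z.1 z.2‖ₑ ^ p ∂(ν.prod ν)
  have hq : 0 < 4 / p - 2 := by rw [sub_pos, lt_div_iff₀ hp0]; linarith
  have e : ENNReal.ofReal (1024 * ((4 / p) / (4 / p - 2)) + 2 + c) * I =
      ENNReal.ofReal (1024 * ((4 / p) / (4 / p - 2))) * I + 2 * I + ENNReal.ofReal c * I := by
    rw [ENNReal.ofReal_add (by positivity) hc, ENNReal.ofReal_add (by positivity) two_pos.le,
      ENNReal.ofReal_ofNat]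
    ring
  rw [e]
  have hB' := hB.trans (show I ≤ 2 * I by rw [two_mul]; exact le_self_add)
  refine le_trans (measure_mono ?_) ((measure_union_le _ _).trans
    (add_le_add ((measure_union_le _ _).trans (add_le_add hA hB')) hlin))
  rintro ω ⟨n, hn⟩
  by_contra hcon
  simp only [Set.mem_union, Set.mem_ofPred_eq, not_or, not_exists, not_lt, not_and] at hcon
  obtain ⟨⟨h1, h2⟩, h3⟩ := hcon
  have e : pairSum h X (n + 1) ω = (∑ j ∈ Finset.range (n + 1), ∑ i ∈ Finset.range j,
      degPart ν (trunc h (level p j)) (X i ω) (X j ω)) + ∑ j ∈ Finset.range (n + 1),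
      ∑ i ∈ Finset.range j, linPart ν (trunc h (level p j)) (X i ω) (X j ω) := by
    unfold pairSum
    simp_rw [← Finset.sum_add_distrib, degPart_add_linPart]
    refine Finset.sum_congr rfl fun j _ => Finset.sum_congr rfl fun i hi => ?_
    rw [trunc, if_pos (h2 j i hi)]
  rw [e] at hn
  have := abs_add_le (∑ j ∈ Finset.range (n + 1), ∑ i ∈ Finset.range j,
      degPart ν (trunc h (level p j)) (X i ω) (X j ω)) (∑ j ∈ Finset.range (n + 1),
      ∑ i ∈ Finset.range j, linPart ν (trunc h (level p j)) (X i ω) (X j ω))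
  have := h1 n
  have := h3 n
  linarith

end IsIIDWithLaw

/-- The weak type inequality with constant `κ`, for all data and all degenerate kernels. -/
def WeakTypeInequality (p κ : ℝ) : Prop :=
  ∀ (Ω : Type u) (E : Type v) [MeasurableSpace Ω] [MeasurableSpace E] (μ : Measure Ω)
    (ν : Measure E) [IsProbabilityMeasure μ] [IsProbabilityMeasure ν] (X : ℕ → Ω → E)
    (h : E → E → ℝ), IsIIDWithLaw X μ ν → IsDegenerateKernel h ν →
    μ {ω | ∃ n, level p n < |pairSum h X (n + 1) ω|} ≤
      ENNReal.ofReal κ * ∫⁻ z, ‖h z.1 z.2‖ₑ ^ p ∂(ν.prod ν)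

theorem exists_weakTypeInequality {p : ℝ} (hp1 : 1 ≤ p) (hp2 : p < 2) :
    ∃ κ, 1 < κ ∧ WeakTypeInequality.{u, v} p κ := by
  have hp0 : 0 < p := by linarith
  have hq : 0 < 4 / p - 2 := by rw [sub_pos, lt_div_iff₀ hp0]; linarith
  have hpos : 0 < 1024 * ((4 / p) / (4 / p - 2)) := by positivity
  rcases hp1.eq_or_lt with rfl | hp1
  · refine ⟨1024 * ((4 / 1) / (4 / 1 - 2)) + 2 + 392, by linarith, ?_⟩
    intro Ω E _ _ μ ν _ _ X h hX hh
    refine hX.measure_exists_level_lt_le hp0 hp2 hh (by norm_num) ?_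
    have := hX.measure_exists_level_one_lt_linPart_le hh.meas fun x => (hh.int x).1
    simpa using this
  · have hr : 0 < 2 - 2 / p := by rw [sub_pos, div_lt_iff₀ hp0]; linarith
    have hc : 0 < 6 * (2 - 2 / p)⁻¹ := by positivity
    refine ⟨1024 * ((4 / p) / (4 / p - 2)) + 2 + 6 * (2 - 2 / p)⁻¹, by linarith, ?_⟩
    intro Ω E _ _ μ ν _ _ X h hX hh
    exact hX.measure_exists_level_lt_le hp0 hp2 hh hc.le
      (hX.measure_exists_level_lt_linPart_le hp1 hp2 hh.meas hh.int)

/-! ### Scaling and almost sure convergence. -/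

section Consequences

variable {Ω : Type u} {E : Type v} [MeasurableSpace Ω] [MeasurableSpace E] {X : ℕ → Ω → E}
  {μ : Measure Ω} {ν : Measure E} [IsProbabilityMeasure μ] [IsProbabilityMeasure ν]
  {h : E → E → ℝ} {p κ : ℝ}

lemma WeakTypeInequality.mul_measure_le (hκ : WeakTypeInequality.{u, v} p κ) (hp : 0 < p)
    (hX : IsIIDWithLaw X μ ν) (hh : IsDegenerateKernel h ν) {x : ℝ} (hx : 0 < x) :
    μ {ω | ∃ n, x * level p n < |pairSum h X (n + 1) ω|} ≤
      (ENNReal.ofReal (x ^ p))⁻¹ * (ENNReal.ofReal κ * ∫⁻ z, ‖h z.1 z.2‖ₑ ^ p ∂(ν.prod ν)) := by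
  have hh' : IsDegenerateKernel (fun y z => x⁻¹ * h y z) ν :=
    ⟨hh.meas.const_mul x⁻¹, fun y z => by rw [hh.symm], fun y =>
      ⟨(hh.int y).1.const_mul _, by rw [integral_const_mul, (hh.int y).2, mul_zero]⟩⟩
  have hm : Measurable fun z : E × E => h z.1 z.2 := hh.meas
  have e1 : {ω | ∃ n, x * level p n < |pairSum h X (n + 1) ω|} =
      {ω | ∃ n, level p n < |pairSum (fun y z => x⁻¹ * h y z) X (n + 1) ω|} := by
    ext ω
    simp only [Set.mem_ofPred_eq]
    refine exists_congr fun n => ?_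
    have : pairSum (fun y z => x⁻¹ * h y z) X (n + 1) ω = x⁻¹ * pairSum h X (n + 1) ω := by
      simp only [pairSum, Finset.mul_sum]
    rw [this, abs_mul, abs_of_pos (inv_pos.2 hx), inv_mul_eq_div, lt_div_iff₀' hx]
  rw [e1]
  refine (hκ Ω E μ ν X _ hX hh').trans_eq ?_
  have e2 : ∀ z : E × E, ‖x⁻¹ * h z.1 z.2‖ₑ ^ p = (ENNReal.ofReal (x ^ p))⁻¹ * ‖h z.1 z.2‖ₑ ^ p := by
    intro z
    rw [enorm_mul, ENNReal.mul_rpow_of_nonneg _ _ hp.le, ← ofReal_abs_rpow hp.le x⁻¹,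
      abs_of_pos (inv_pos.2 hx), Real.inv_rpow hx.le,
      ENNReal.ofReal_inv_of_pos (Real.rpow_pos_of_pos hx p)]
  simp_rw [e2]
  rw [lintegral_const_mul _ (by fun_prop), mul_left_comm]

/-- A bounded kernel has all moments, so the weak type inequality at some q > p makes the maximal
function with normalisation n^(2/q) almost surely finite; the factor n^(2/q - 2/p) then tends to 0.
-/
lemma ae_tendsto_of_bounded (hp1 : 1 ≤ p) (hp2 : p < 2) (hX : IsIIDWithLaw X μ ν)
    (hh : IsDegenerateKernel h ν) {C : ℝ} (hC : ∀ x y, |h x y| ≤ C) :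
    ∀ᵐ ω ∂μ, Tendsto (fun n => (level p n)⁻¹ * |pairSum h X (n + 1) ω|) atTop (𝓝 0) := by
  -- The midpoint of p and 2 stays in the admissible range.
  set q := (p + 2) / 2 with hq
  have hq0 : 0 < q := by linarith
  obtain ⟨κ, -, hκ⟩ := exists_weakTypeInequality.{u, v} (p := q) (by linarith) (by linarith)
  have hI : ∫⁻ z, ‖h z.1 z.2‖ₑ ^ q ∂(ν.prod ν) ≠ ∞ := by
    have hle : ∫⁻ z, ‖h z.1 z.2‖ₑ ^ q ∂(ν.prod ν) ≤ ∫⁻ z, ENNReal.ofReal C ^ q ∂(ν.prod ν) := by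
      refine lintegral_mono fun z => ?_
      beta_reduce
      rw [Real.enorm_eq_ofReal_abs]
      gcongr
      exact hC _ _
    refine ne_top_of_le_ne_top ?_ hle
    rw [lintegral_const, measure_univ, mul_one]
    exact ENNReal.rpow_ne_top_of_nonneg hq0.le ENNReal.ofReal_ne_top
  have hfin := fun T : ℕ => hκ.mul_measure_le hq0 hX hh (show (0 : ℝ) < (T : ℝ) + 1 by positivity)
  have hlim : Tendsto (fun T : ℕ => (ENNReal.ofReal (((T : ℝ) + 1) ^ q))⁻¹ *
      (ENNReal.ofReal κ * ∫⁻ z, ‖h z.1 z.2‖ₑ ^ q ∂(ν.prod ν))) atTop (𝓝 0) := by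
    have h1 : Tendsto (fun T : ℕ => (ENNReal.ofReal (((T : ℝ) + 1) ^ q))⁻¹) atTop (𝓝 0) := by
      rw [← ENNReal.inv_top]
      refine (ENNReal.tendsto_ofReal_atTop.comp ((tendsto_rpow_atTop hq0).comp ?_)).inv
      exact tendsto_atTop_add_const_right _ _ tendsto_natCast_atTop_atTop
    have := ENNReal.Tendsto.mul_const h1 (Or.inr (ENNReal.mul_ne_top (ENNReal.ofReal_ne_top (r := κ)) hI))
    simpa using this
  filter_upwards [ae_exists_notMem_of_tendsto hfin hlim] with ω ⟨T, hT⟩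
  simp only [not_exists, not_lt] at hT
  have hexp : 0 < 2 / p - 2 / q := by
    rw [sub_pos]
    exact div_lt_div_of_pos_left two_pos (by linarith) (by linarith)
  have hlim2 : Tendsto (fun n : ℕ => ((T : ℝ) + 1) * ((n : ℝ) + 1) ^ (-(2 / p - 2 / q)))
      atTop (𝓝 0) := by
    have := ((tendsto_rpow_neg_atTop hexp).comp (tendsto_atTop_add_const_right _ (1 : ℝ)
      tendsto_natCast_atTop_atTop)).const_mul ((T : ℝ) + 1)
    simpa using this
  refine squeeze_zero (fun n => ?_) (fun n => ?_) hlim2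
  · have := level_pos p n
    positivity
  · have hl := level_pos p n
    have hn : (0 : ℝ) < (n : ℝ) + 1 := by positivity
    calc (level p n)⁻¹ * |pairSum h X (n + 1) ω| ≤ (level p n)⁻¹ * (((T : ℝ) + 1) * level q n) := by
          gcongr; exact hT n
      _ = _ := by
          unfold level
          rw [neg_sub, Real.rpow_sub hn]
          field_simp

lemma IsDegenerateKernel.degPart_trunc (hh : IsDegenerateKernel h ν) {c : ℝ} (hc : 0 ≤ c) :
    IsDegenerateKernel (degPart ν (trunc h c)) ν where
  meas := measurable_degPart (measurable_trunc hh.meas c)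
  symm := degPart_symm (trunc_symm hh.symm c)
  int x := ⟨integrable_of_abs_le
    (measurable_section (measurable_degPart (measurable_trunc hh.meas c)) x).stronglyMeasurable
      ⟨_, abs_degPart_le (abs_trunc_le hc) x⟩,
    integral_degPart (measurable_trunc hh.meas c) (abs_trunc_le hc) x⟩

/-- A degenerate kernel is its own degenerate part, so the error is the degenerate part of the tail
and is small in L^p whenever the tail is. -/
lemma IsDegenerateKernel.sub_degPart_trunc (hh : IsDegenerateKernel h ν) {c : ℝ} (hc : 0 ≤ c)
    (x y : E) : h x y - degPart ν (trunc h c) x y =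
      degPart ν (fun x y => h x y - trunc h c x y) x y := by
  have e : ∀ x, proj ν (fun x y => h x y - trunc h c x y) x = -proj ν (trunc h c) x := fun x => by
    rw [proj_trunc_eq hh.meas hc (hh.int x).1 (hh.int x).2, neg_neg]
  unfold degPart
  simp_rw [e]
  rw [integral_neg]
  ring

lemma IsDegenerateKernel.tendsto_lintegral_sub (hh : IsDegenerateKernel h ν) (hp1 : 1 ≤ p)
    (hI : ∫⁻ z, ‖h z.1 z.2‖ₑ ^ p ∂(ν.prod ν) ≠ ∞) :
    Tendsto (fun T : ℕ => ∫⁻ z, ‖h z.1 z.2 - degPart ν (trunc h T) z.1 z.2‖ₑ ^ p ∂(ν.prod ν))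
      atTop (𝓝 0) := by
  have hp0 : 0 < p := by linarith
  have hm : Measurable fun z : E × E => h z.1 z.2 := hh.meas
  have hkm : ∀ T : ℕ, Measurable fun z : E × E => trunc h T z.1 z.2 := fun T =>
    measurable_trunc hh.meas T
  have h1 : Tendsto (fun T : ℕ => ∫⁻ z, ‖h z.1 z.2 - trunc h T z.1 z.2‖ₑ ^ p ∂(ν.prod ν))
      atTop (𝓝 (∫⁻ _, 0 ∂(ν.prod ν))) := by
    refine tendsto_lintegral_of_dominated_convergence (fun z => ‖h z.1 z.2‖ₑ ^ p) (fun T => ?_)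
      (fun T => ae_of_all _ fun z => ?_) hI (ae_of_all _ fun z => ?_)
    · have := hkm T
      fun_prop
    · beta_reduce
      rw [sub_trunc]
      split_ifs
      · exact le_rfl
      · simp [hp0]
    · refine tendsto_const_nhds.congr' ?_
      obtain ⟨N, hN⟩ := exists_nat_ge (|h z.1 z.2|)
      filter_upwards [eventually_ge_atTop N] with T hT
      have : (N : ℝ) ≤ T := by exact_mod_cast hT
      rw [sub_trunc, if_neg (by linarith), enorm_zero, ENNReal.zero_rpow_of_pos hp0]
  rw [lintegral_zero] at h1
  have h2 := ENNReal.Tendsto.const_mul (a := 4 ^ p * 4) h1 (Or.inr (ENNReal.mul_ne_top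
    (ENNReal.rpow_ne_top_of_nonneg hp0.le ENNReal.ofNat_ne_top) ENNReal.ofNat_ne_top))
  rw [mul_zero] at h2
  refine tendsto_of_tendsto_of_tendsto_of_le_of_le tendsto_const_nhds h2 (fun _ => zero_le)
    fun T => ?_
  beta_reduce
  simp_rw [hh.sub_degPart_trunc (Nat.cast_nonneg T)]
  exact lintegral_degPart_rpow_le hp1 (hh.meas.sub (measurable_trunc hh.meas T))

/-- Banach principle: convergence on the dense class of bounded degenerate kernels, plus the weak
type inequality for the difference. -/
theorem ae_tendsto_pairSum (hp1 : 1 ≤ p) (hp2 : p < 2) (hX : IsIIDWithLaw X μ ν)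
    (hh : IsDegenerateKernel h ν) (hI : ∫⁻ z, ‖h z.1 z.2‖ₑ ^ p ∂(ν.prod ν) ≠ ∞) :
    ∀ᵐ ω ∂μ, Tendsto (fun n => (level p n)⁻¹ * |pairSum h X (n + 1) ω|) atTop (𝓝 0) := by
  have hp0 : 0 < p := by linarith
  obtain ⟨κ, -, hκ⟩ := exists_weakTypeInequality.{u, v} hp1 hp2
  have hk := fun T : ℕ => hh.degPart_trunc (Nat.cast_nonneg (α := ℝ) T)
  have hbdd : ∀ᵐ ω ∂μ, ∀ T : ℕ, Tendsto
      (fun n => (level p n)⁻¹ * |pairSum (degPart ν (trunc h T)) X (n + 1) ω|) atTop (𝓝 0) :=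
    ae_all_iff.2 fun T => ae_tendsto_of_bounded hp1 hp2 hX (hk T)
      (abs_degPart_le (abs_trunc_le (Nat.cast_nonneg T)))
  -- The truncation level may depend on ω: for fixed m the exceptional sets have measure tending to
  -- 0 in `T`, so almost every ω escapes one of them.
  have hrest : ∀ᵐ ω ∂μ, ∀ m : ℕ, ∃ T : ℕ, ∀ n, |pairSum (fun x y => h x y -
      degPart ν (trunc h T) x y) X (n + 1) ω| ≤ 1 / ((m : ℝ) + 1) * level p n := by
    refine ae_all_iff.2 fun m => ?_
    have hx : (0 : ℝ) < 1 / ((m : ℝ) + 1) := by positivity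
    have hS := fun T : ℕ => hκ.mul_measure_le hp0 hX (hh.sub (hk T)) hx
    have hne : (ENNReal.ofReal ((1 / ((m : ℝ) + 1)) ^ p))⁻¹ ≠ ∞ := by
      rw [ENNReal.inv_ne_top, ne_eq, ENNReal.ofReal_eq_zero, not_le]
      positivity
    have hlim := ENNReal.Tendsto.const_mul (ENNReal.Tendsto.const_mul
      (hh.tendsto_lintegral_sub hp1 hI) (Or.inr (ENNReal.ofReal_ne_top (r := κ)))) (Or.inr hne)
    rw [mul_zero, mul_zero] at hlim
    filter_upwards [ae_exists_notMem_of_tendsto hS hlim] with ω ⟨T, hT⟩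
    simp only [not_exists, not_lt] at hT
    exact ⟨T, hT⟩
  filter_upwards [hbdd, hrest] with ω h1 h2
  rw [Metric.tendsto_atTop]
  intro δ hδ
  obtain ⟨m, hm⟩ := exists_nat_one_div_lt (half_pos hδ)
  obtain ⟨T, hT⟩ := h2 m
  obtain ⟨N, hN⟩ := (Metric.tendsto_atTop.1 (h1 T)) (δ / 2) (half_pos hδ)
  refine ⟨N, fun n hn => ?_⟩
  have hl := level_pos p n
  have h3 := hN n hn
  have h4 := hT n
  rw [Real.dist_0_eq_abs, abs_of_nonneg (by positivity)] at h3 ⊢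
  rw [pairSum_sub] at h4
  have h5 := abs_sub_abs_le_abs_sub (pairSum h X (n + 1) ω)
    (pairSum (degPart ν (trunc h T)) X (n + 1) ω)
  calc (level p n)⁻¹ * |pairSum h X (n + 1) ω| ≤ (level p n)⁻¹ *
        (|pairSum (degPart ν (trunc h T)) X (n + 1) ω| + 1 / ((m : ℝ) + 1) * level p n) := by
        gcongr; linarith
    _ = (level p n)⁻¹ * |pairSum (degPart ν (trunc h T)) X (n + 1) ω| + 1 / ((m : ℝ) + 1) := by
        field_simp
    _ < δ := by linarith

end Consequences

/-! ### Translation to the original statement. -/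

section Reindex

lemma UInd_eq_pairSum {Ω E : Type*} (h : E → E → ℝ) (ε : ℤ → Ω → E) (n : ℕ) (ω : Ω) :
    UInd h (fun i => ε i ω) n = pairSum h (fun i : ℕ => ε (i + 1 : ℕ)) n ω := by
  have hIcc : Finset.Icc 1 n = Finset.Ico (0 + 1) (n + 1) := by ext; simp
  unfold UInd pairSum
  rw [hIcc, ← Finset.sum_Ico_add', Finset.range_eq_Ico]
  refine Finset.sum_congr rfl fun j _ => ?_
  rw [Finset.range_eq_Ico, Finset.sum_Ico_add' (fun i : ℕ => h (ε i ω) (ε (j + 1 : ℕ) ω)) 0 j 1]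

lemma inv_level_eq_rpow (p : ℝ) (n : ℕ) : (level p n)⁻¹ = ((n + 1 : ℕ) : ℝ) ^ (-(2 / p)) := by
  unfold level
  rw [Real.rpow_neg (by positivity)]
  push_cast
  rfl

lemma lt_maximalFun_iff {Ω E : Type*} (p : ℝ) (h : E → E → ℝ) (ε : ℤ → Ω → E) (ω : Ω) {x : ℝ} (hx : 0 ≤ x) :
    ENNReal.ofReal x < maximalFun p h (fun i => ε i ω) ↔
      ∃ n, x * level p n < |pairSum h (fun i : ℕ => ε (i + 1 : ℕ)) (n + 1) ω| := by
  have key : ∀ n : ℕ, ENNReal.ofReal x < ENNReal.ofReal (((n + 1 : ℕ) : ℝ) ^ (-(2 / p)) *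
      |UInd h (fun i => ε i ω) (n + 1)|) ↔
      x * level p n < |pairSum h (fun i : ℕ => ε (i + 1 : ℕ)) (n + 1) ω| := fun n => by
    rw [ENNReal.ofReal_lt_ofReal_iff_of_nonneg hx, ← inv_level_eq_rpow, UInd_eq_pairSum,
      inv_mul_eq_div, lt_div_iff₀ (level_pos p n)]
  simp only [maximalFun, lt_iSup_iff, ← key]
  constructor
  · rintro ⟨n, hn, hlt⟩
    obtain ⟨m, rfl⟩ := Nat.exists_eq_add_of_le' hn
    exact ⟨m, hlt⟩
  · rintro ⟨n, hlt⟩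
    exact ⟨n + 1, by omega, hlt⟩

variable {Ω E : Type*} [MeasurableSpace Ω] [MeasurableSpace E] {ε : ℤ → Ω → E} {μ : Measure Ω}

lemma IsIIDSeq.isIIDWithLaw (hε : IsIIDSeq ε μ) {f : ℕ → ℤ} (hf : Function.Injective f) :
    IsIIDWithLaw (fun i => ε (f i)) μ (μ.map (ε 0)) where
  meas _ := hε.measurable _
  indep := hε.indep.precomp hf
  law _ := (hε.identDistrib _).map_eq

lemma IsIIDSeq.isDegenerateKernel (hε : IsIIDSeq ε μ) {h : E → E → ℝ}
    (hm : Measurable (Function.uncurry h)) (hsymm : ∀ x y, h x y = h y x)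
    (hdeg : ∀ x, Integrable (fun ω => h (ε 0 ω) x) μ ∧ ∫ ω, h (ε 0 ω) x ∂μ = 0) :
    IsDegenerateKernel h (μ.map (ε 0)) where
  meas := hm
  symm := hsymm
  int x := by
    have hs := measurable_section hm x
    have e : h x ∘ ε 0 = fun ω => h (ε 0 ω) x := by
      funext ω; exact hsymm _ _
    rw [integrable_map_measure hs.aestronglyMeasurable (hε.measurable 0).aemeasurable,
      integral_map (hε.measurable 0).aemeasurable hs.aestronglyMeasurable, e]
    refine ⟨(hdeg x).1, ?_⟩
    simpa only [hsymm x] using (hdeg x).2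

/-- By independence, the pair (`ε 0`, `ε 1`) has the product law. -/
lemma IsIIDSeq.lintegral_kernel [IsProbabilityMeasure μ] (hε : IsIIDSeq ε μ) {h : E → E → ℝ}
    {p : ℝ} (hp : 0 ≤ p) (hm : Measurable (Function.uncurry h))
    (hint : Integrable (fun ω => |h (ε 0 ω) (ε 1 ω)| ^ p) μ) :
    ∫⁻ z, ‖h z.1 z.2‖ₑ ^ p ∂((μ.map (ε 0)).prod (μ.map (ε 0))) =
      ENNReal.ofReal (∫ ω, |h (ε 0 ω) (ε 1 ω)| ^ p ∂μ) := by
  have hm' : Measurable fun z : E × E => h z.1 z.2 := hm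
  have hX := hε.isIIDWithLaw (f := fun i : ℕ => (i : ℤ)) Nat.cast_injective
  rw [← hX.lintegral_pair zero_ne_one (f := fun z => ‖h z.1 z.2‖ₑ ^ p) (by fun_prop),
    ofReal_integral_eq_lintegral_ofReal hint (ae_of_all _ fun ω => by positivity)]
  simp_rw [ofReal_abs_rpow hp]
  rfl

end Reindex

theorem mainTheorem6 (p : ℝ) (hp1 : 1 ≤ p) (hp2 : p < 2) :
    ∃ κ : ℝ, 1 < κ ∧
      ∀ (d : ℕ) (Ω : Type*) [MeasurableSpace Ω] (μ : Measure Ω) [IsProbabilityMeasure μ]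
        (ε : ℤ → Ω → EuclideanSpace ℝ (Fin d))
        (h : EuclideanSpace ℝ (Fin d) → EuclideanSpace ℝ (Fin d) → ℝ),
        IsIIDSeq ε μ →
        Measurable (Function.uncurry h) →
        (∀ x y, h x y = h y x) →
        Integrable (fun ω => |h (ε 0 ω) (ε 1 ω)| ^ p) μ →
        (∀ x, Integrable (fun ω => h (ε 0 ω) x) μ ∧ ∫ ω, h (ε 0 ω) x ∂μ = 0) →
        (∀ᵐ ω ∂μ, Tendsto
          (fun n : ℕ => (n : ℝ) ^ (-(2 / p)) * |UInd h (fun i => ε i ω) n|) atTop (𝓝 0)) ∧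
        (∀ x : ℝ, 0 < x →
          x ^ p * μ.real {ω | ENNReal.ofReal x < maximalFun p h (fun i => ε i ω)} ≤
            κ * ∫ ω, |h (ε 0 ω) (ε 1 ω)| ^ p ∂μ) := by
  have hp0 : 0 < p := by linarith
  obtain ⟨κ, hκ1, hκ⟩ := exists_weakTypeInequality hp1 hp2
  refine ⟨κ, hκ1, ?_⟩
  intro d Ω _ μ _ ε h hε hm hsymm hint hdeg
  have hν : IsProbabilityMeasure (μ.map (ε 0)) :=
    Measure.isProbabilityMeasure_map (hε.measurable 0).aemeasurable
  have hX : IsIIDWithLaw (fun i : ℕ => ε (i + 1 : ℕ)) μ (μ.map (ε 0)) :=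
    hε.isIIDWithLaw (f := fun i : ℕ => ((i + 1 : ℕ) : ℤ)) fun a b hab => by simpa using hab
  have hh := hε.isDegenerateKernel hm hsymm hdeg
  have hI := hε.lintegral_kernel hp0.le hm hint
  constructor
  · filter_upwards [ae_tendsto_pairSum hp1 hp2 hX hh (hI ▸ ENNReal.ofReal_ne_top)] with ω hω
    -- `level p n` is the normalisation at n + 1, so the sequence is shifted by one.
    rw [← tendsto_add_atTop_iff_nat 1]
    refine hω.congr fun n => ?_
    rw [inv_level_eq_rpow, UInd_eq_pairSum]
  · intro x hx
    have hxp : 0 < x ^ p := Real.rpow_pos_of_pos hx p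
    have hweak := hκ.mul_measure_le hp0 hX hh hx
    simp_rw [lt_maximalFun_iff p h ε _ hx.le]
    rw [hI, ← ENNReal.ofReal_mul (by linarith), ← ENNReal.ofReal_inv_of_pos hxp,
      ← ENNReal.ofReal_mul (by positivity)] at hweak
    have hnonneg : 0 ≤ ∫ ω, |h (ε 0 ω) (ε 1 ω)| ^ p ∂μ := integral_nonneg fun ω => by positivity
    have h1 := ENNReal.toReal_le_of_le_ofReal (by positivity) hweak
    calc _ ≤ x ^ p * ((x ^ p)⁻¹ * (κ * ∫ ω, |h (ε 0 ω) (ε 1 ω)| ^ p ∂μ)) := by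
          gcongr; exact h1
      _ = _ := by rw [← mul_assoc, mul_inv_cancel₀ hxp.ne', one_mul]
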